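/- **Setting.** A circuit on $n$ qubits starts from $|0\rangle^{\otimes n}$, consists of $m\ge 1$ cycles of one-qubit gates $U_1,\dots,U_m$, with a cycle $cZ_j$ of controlled-$Z$ gates on disjoint pairs of qubits after each $U_j$, $1\le j\le m-1$, and ends with a measurement in the computational basis. The one-qubit gates of the *target circuit* are arbitrary unitaries. *Trap circuits* have the same $cZ$ cycles. Their one-qubit gates are random: for each $j\le m-1$, if $cZ_j$ connects qubits $i,i'$, one of them, chosen uniformly, gets $S$ and the other one gets $H$ before $cZ_j$; each unconnected qubit gets $H$ or $S$ uniformly; these gates are undone after $cZ_j$. A uniform bit $t$ is drawn, and if $t=1$ a layer of Hadamard gates is added at the beginning and at the end. All choices are independent, and neighbouring one-qubit gates are compiled into a single cycle. *Noise* is Markovian and independent of the one-qubit gates: there are CPTP maps $\mathcal R,\mathcal E_1,\dots,\mathcal E_m$ on all $n$ qubits, the same for all circuits, with $\mathcal R$ acting after the state preparation, $\mathcal E_j$ acting after $cZ_jU_j$ for $j<m$, and $\mathcal E_m$ acting between $U_m$ and the measurement (it includes measurement noise). *Quantum one-time pad.* In each run, independent uniform Pauli strings $A_1,\dots,A_m\in\{I,X,Y,Z\}^{\otimes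 n}$ are applied, $A_j$ right after $U_j$; for $j<m$ it is undone, by the Pauli string $cZ_jA_jcZ_j$, before $U_{j+1}$, and $A_m$ is undone by flipping the measured bits. Before $U_1$ a uniformly random string of $I$'s and $Z$'s is applied, which fixes $|0\rangle^{\otimes n}$. The compiled cycles suffer the noise above. The experimental output distribution $p_{\rm exp}$ is averaged over the pad; $p_{\rm ideal}$ is the output distribution without noise. *Error rates.* For $1\le j\le m-1$ let $q_j(P)=4^{-n}\sum_K|\mathrm{tr}(P^\dagger K)|^2$, over Kraus operators $K$ of $\mathcal E_j$, be the weights of the Pauli twirl of $\mathcal E_j$. A Pauli $Z$ is trivial on $|0\rangle$ and before the measurement, so that preparation and measurement errors matter only through the bits that they flip; they are represented by Pauli strings $P_0,P_m\in\{I,Y\}^{\otimes n}$, with $Y$ on the flipped bits. Thus $q_0(P)=\langle a|\mathcal R(|0\rangle\langle 0|^{\otimes n})|a\rangle$, where $a$ is the set of bits flipped by $P$, $q_m(P)$ is the total weight, in the Pauli twirl of $\mathcal E_m$, of the Pauli strings that flip the same bits as $P$, and $q_0(P)=q_m(P)=0$ if $P\notin\{I,Y\}^{\otimes n}$. Let $$p_{\rm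 err}=\sum_{(P_0,\dots,P_m)\ne(I,\dots,I)}q_0(P_0)\cdots q_m(P_m).$$ Let $p_{\rm inc}$ be the probability (over the trap's random gates, the pad and the noise) that a trap circuit returns an output other than $(0,\dots,0)$. A pattern $(P_0,\dots,P_m)$ *cancels* in a trap circuit if the single Pauli error obtained by commuting all $P_j$ to one place of the circuit is the identity (up to a phase). Let $p_{\rm canc}$ be the conditional probability that the pattern of errors cancels in a random trap circuit, given that $(P_0,\dots,P_m)\neq (I,\dots,I)$ (and $p_{\rm canc}=0$ if $p_{\rm err}=0$). **Theorem.** Each $q_j$ is a probability distribution, and the noise is twirled into stochastic Pauli errors: for every choice of unitary one-qubit gates and every bit string $\bar s$, $$p_{\rm exp}(\bar s)=\sum_{P_0,\dots,P_m}q_0(P_0)\cdots q_m(P_m)\,\bigl|\langle \bar s|P_mU_m\,P_{m-1}cZ_{m-1}U_{m-1}\cdots P_1cZ_1U_1\,P_0|0^n\rangle\bigr|^2 .$$ The target circuit satisfies $$\mathrm{VD}:=\tfrac12\sum_{\bar s}\bigl|p_{\rm ideal}(\bar s)-p_{\rm exp}(\bar s)\bigr|\le p_{\rm err},$$ and, if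 $p_{\rm canc}<1$, $$p_{\rm err}\le\frac{2p_{\rm inc}}{1-p_{\rm canc}} .$$ Moreover $p_{\rm inc}\le p_{\rm err}$. -/

import Mathlib

namespace Accreditation

noncomputable section

/-! ### Qubits, Pauli strings, gates -/

/-- Operators on `n` qubits, in the computational basis of bit strings. -/
abbrev Op (n : ℕ) : Type := Matrix (Fin n → Fin 2) (Fin n → Fin 2) ℂ

/-- The map `ρ ↦ V ρ V†`. -/
def conjBy {n : ℕ} (V ρ : Op n) : Op n := V * ρ * V.conjTranspose

/-- Tensor product of one-qubit operators. -/
def tensor {n : ℕ} (A : Fin n → Matrix (Fin 2) (Fin 2) ℂ) : Op n :=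
  Matrix.of fun r c => ∏ i, A i (r i) (c i)

/-- The state `|0⟩⟨0|^{⊗ n}`. -/
def zeroState (n : ℕ) : Op n := Matrix.single 0 0 1

inductive Pauli where
  | I | X | Y | Z
  deriving DecidableEq

instance : Fintype Pauli where
  elems := {Pauli.I, Pauli.X, Pauli.Y, Pauli.Z}
  complete := fun P => by cases P <;> decide

def Pauli.mat : Pauli → Matrix (Fin 2) (Fin 2) ℂ
  | .I => !![1, 0; 0, 1]
  | .X => !![0, 1; 1, 0]
  | .Y => !![0, -Complex.I; Complex.I, 0]
  | .Z => !![1, 0; 0, -1]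

/-- Whether the Pauli operator flips a bit in the computational basis. -/
def Pauli.flip : Pauli → Fin 2
  | .I => 0
  | .X => 1
  | .Y => 1
  | .Z => 0

/-- Elements of `{I, X, Y, Z}^{⊗ n}`. -/
abbrev PauliString (n : ℕ) : Type := Fin n → Pauli

def pauliOp {n : ℕ} (P : PauliString n) : Op n := tensor fun i => (P i).mat

/-- The set of bits flipped by a Pauli string, as a bit string. -/
def flips {n : ℕ} (P : PauliString n) : Fin n → Fin 2 := fun i => (P i).flip

/-- The Hadamard gate `(X + Z) / √2`. -/
def gateH : Matrix (Fin 2) (Fin 2) ℂ := ((Real.sqrt 2 : ℝ) : ℂ)⁻¹ • !![1, 1; 1, -1]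

/-- The phase gate. -/
def gateS : Matrix (Fin 2) (Fin 2) ℂ := !![1, 0; 0, Complex.I]

/-- A cycle of `cZ` gates on disjoint pairs of qubits: qubit `i` is connected to `partner i`,
and it takes part in no gate of the cycle if `partner i = i`. -/
structure CZCycle (n : ℕ) where
  partner : Fin n → Fin n
  involutive : Function.Involutive partner

/-- The unitary of a cycle of `cZ` gates. -/
def CZCycle.op {n : ℕ} (c : CZCycle n) : Op n :=
  Matrix.diagonal fun s =>
    ∏ i, if i < c.partner i ∧ s i = 1 ∧ s (c.partner i) = 1 then (-1 : ℂ) else 1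

/-- The one-qubit gates of a circuit with `m = k + 1` cycles of one-qubit gates
(cycle, then qubit). Any two consecutive cycles are separated by a cycle of `cZ` gates. -/
abbrev Gates (n k : ℕ) : Type := Fin (k + 1) → Fin n → Matrix (Fin 2) (Fin 2) ℂ

/-! ### Noise -/

abbrev SuperOp (n : ℕ) : Type := Op n →ₗ[ℂ] Op n

/-- The map `id_d ⊗ Φ`, on block matrices. -/
def ampliation {n : ℕ} (Φ : SuperOp n) (d : ℕ)
    (M : Matrix (Fin d × (Fin n → Fin 2)) (Fin d × (Fin n → Fin 2)) ℂ) :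
    Matrix (Fin d × (Fin n → Fin 2)) (Fin d × (Fin n → Fin 2)) ℂ :=
  Matrix.of fun x y => Φ (Matrix.of fun r c => M (x.1, r) (y.1, c)) x.2 y.2

open scoped ComplexOrder in
/-- Completely positive trace-preserving maps. -/
structure IsCPTP {n : ℕ} (Φ : SuperOp n) : Prop where
  completelyPositive : ∀ (d : ℕ)
    (M : Matrix (Fin d × (Fin n → Fin 2)) (Fin d × (Fin n → Fin 2)) ℂ),
    M.PosSemidef → (ampliation Φ d M).PosSemidef
  tracePreserving : ∀ ρ : Op n, (Φ ρ).trace = ρ.trace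

/-- Markovian noise with gate-independent noise of the one-qubit gates. The map `prep` is the noise
of the state preparation. The map `cycle j` is the noise of the `j`-th cycle of one-qubit gates
together with the cycle of `cZ` gates, or (for the last `j`) the measurement, that follows it.
The maps act on all qubits; since `cycle j` does not depend on the one-qubit gates, all circuits
with the same cycles of `cZ` gates suffer the same noise. -/
structure Noise (n k : ℕ) where
  prep : SuperOp n
  cycle : Fin (k + 1) → SuperOp n
  prep_isCPTP : IsCPTP prep
  cycle_isCPTP : ∀ j, IsCPTP (cycle j)

/-! ### Noisy circuits with the quantum one-time pad -/

/-- The state before the measurement in a noisy run in which the quantum one-time pad uses the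
random Pauli strings `A j` after the `j`-th cycle of one-qubit gates, and the random `Z` gates
`g` (which fix the ideal input `|0⟩^{⊗ n}`) before the first one. For `j` not the last
cycle, `A j` is undone by the Pauli string `cZ (A j) cZ` at the beginning of the next cycle of
one-qubit gates. -/
def noisyState {n k : ℕ} (N : Noise n k) (cz : Fin k → CZCycle n) (U : Gates n k)
    (g : Fin n → Fin 2) (A : Fin (k + 1) → PauliString n) : Op n :=
  let ρ := Fin.foldl k
    (fun ρ j =>
      conjBy ((cz j).op * pauliOp (A j.castSucc) * (cz j).op)
        (N.cycle j.castSucc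
          (conjBy (cz j).op
            (conjBy (pauliOp (A j.castSucc)) (conjBy (tensor (U j.castSucc)) ρ)))))
    (conjBy (pauliOp fun i => if g i = 1 then Pauli.Z else Pauli.I) (N.prep (zeroState n)))
  N.cycle (Fin.last k)
    (conjBy (pauliOp (A (Fin.last k))) (conjBy (tensor (U (Fin.last k))) ρ))

/-- The experimental output distribution of a circuit: the last Pauli string of the one-time pad is
undone by flipping the measured bits, and the pad is uniformly random. -/
def expDist {n k : ℕ} (N : Noise n k) (cz : Fin k → CZCycle n) (U : Gates n k)
    (s : Fin n → Fin 2) : ℝ :=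
  (∑ g : Fin n → Fin 2, ∑ A : Fin (k + 1) → PauliString n,
      (noisyState N cz U g A (s + flips (A (Fin.last k))) (s + flips (A (Fin.last k)))).re) /
    (Fintype.card (Fin n → Fin 2) * Fintype.card (Fin (k + 1) → PauliString n))

/-! ### Patterns of Pauli errors -/

/-- A pattern `P_0, …, P_m` of Pauli errors, with `m = k + 1`. -/
abbrev Pattern (n k : ℕ) : Type := Fin (k + 2) → PauliString n

def noError (n k : ℕ) : Pattern n k := fun _ _ => Pauli.I

/-- The operator `P_m U_m ⋯ P_1 cZ_1 U_1 P_0` of a circuit with a pattern of errors. -/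
def faultyOp {n k : ℕ} (cz : Fin k → CZCycle n) (U : Gates n k) (P : Pattern n k) : Op n :=
  pauliOp (P (Fin.last (k + 1))) * tensor (U (Fin.last k)) *
    Fin.foldl k
      (fun V j => pauliOp (P j.castSucc.succ) * (cz j).op * tensor (U j.castSucc) * V)
      (pauliOp (P 0))

/-- The output distribution of a circuit with a pattern of errors, on input `|0⟩^{⊗ n}`. -/
def patternDist {n k : ℕ} (cz : Fin k → CZCycle n) (U : Gates n k) (P : Pattern n k)
    (s : Fin n → Fin 2) : ℝ := ‖faultyOp cz U P s 0‖ ^ 2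

/-- The ideal output distribution. -/
def idealDist {n k : ℕ} (cz : Fin k → CZCycle n) (U : Gates n k) : (Fin n → Fin 2) → ℝ :=
  patternDist cz U (noError n k)

/-- The variation distance between ideal and experimental outputs. -/
def varDist {n k : ℕ} (N : Noise n k) (cz : Fin k → CZCycle n) (U : Gates n k) : ℝ :=
  (1 / 2) * ∑ s, |idealDist cz U s - expDist N cz U s|

/-- The weight of the Pauli string `P` in the Pauli twirl of `Φ`, a diagonal entry of the process
matrix: it is `4⁻ⁿ ∑ |tr (P† K)|²`, summed over Kraus operators `K` of `Φ`. -/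
def twirlRate {n : ℕ} (Φ : SuperOp n) (P : PauliString n) : ℝ :=
  ((∑ r : Fin n → Fin 2, ∑ c : Fin n → Fin 2,
      ((pauliOp P).conjTranspose * Φ (Matrix.single r c 1) * pauliOp P) r c) / 4 ^ n).re

/-- Errors of preparation and of measurement matter only through the bits that they flip, since `Z`
is trivial on `|0⟩` and before a measurement. They are represented by `Y` on the flipped bits. -/
def IsFlipString {n : ℕ} (P : PauliString n) : Prop := ∀ i, P i = Pauli.I ∨ P i = Pauli.Y

open Classical in
/-- Probability of the preparation error `P`. -/
def prepRate {n : ℕ} (Φ : SuperOp n) (P : PauliString n) : ℝ :=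
  if IsFlipString P then (Φ (zeroState n) (flips P) (flips P)).re else 0

open Classical in
/-- Probability of the error `P` at the measurement. -/
def measRate {n : ℕ} (Φ : SuperOp n) (P : PauliString n) : ℝ :=
  if IsFlipString P then ∑ P' : PauliString n, if flips P' = flips P then twirlRate Φ P' else 0
  else 0

/-- The probability `q_j(P)` of the Pauli error `P` in cycle `j ∈ {0, …, m}`. -/
def errorRate {n k : ℕ} (N : Noise n k) (j : Fin (k + 2)) (P : PauliString n) : ℝ :=
  Fin.cases (motive := fun _ => ℝ) (prepRate N.prep P)
    (fun i : Fin (k + 1) =>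
      if i = Fin.last k then measRate (N.cycle i) P else twirlRate (N.cycle i) P) j

/-- The probability `q_0(P_0) ⋯ q_m(P_m)` of a pattern of errors. -/
def patternProb {n k : ℕ} (N : Noise n k) (P : Pattern n k) : ℝ := ∏ j, errorRate N j (P j)

/-- The total probability of error. -/
def pErr {n k : ℕ} (N : Noise n k) : ℝ :=
  ∑ P ∈ Finset.univ.filter (fun P : Pattern n k => P ≠ noError n k), patternProb N P

/-! ### Trap circuits -/

/-- The random choices that define a trap circuit: the bit `t` and, for every cycle of `cZ` gates and
every qubit, whether `H` (`true`) or `S` (`false`) replaces the gate before it. -/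
abbrev TrapChoice (n k : ℕ) : Type := Bool × (Fin k → Fin n → Bool)

open Classical in
/-- The admissible choices: of two connected qubits one gets `S` and the other one `H`. -/
def trapChoices {n k : ℕ} (cz : Fin k → CZCycle n) : Finset (TrapChoice n k) :=
  Finset.univ.filter fun c =>
    ∀ j i, (cz j).partner i ≠ i → c.2 j ((cz j).partner i) = !(c.2 j i)

/-- The one-qubit gates of a trap circuit. In cycle `j`, the gates placed after the previous cycle of
`cZ` gates to undo the random ones (or the initial layer `H^t`) and the gates placed before the
next cycle of `cZ` gates (or the final layer `H^t`) are compiled into one. -/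
def trapGates {n k : ℕ} (c : TrapChoice n k) : Gates n k := fun j i =>
  let layerH : Matrix (Fin 2) (Fin 2) ℂ := if c.1 then gateH else 1
  let gate : Fin k → Matrix (Fin 2) (Fin 2) ℂ := fun l => if c.2 l i then gateH else gateS
  Fin.lastCases (motive := fun _ => Matrix (Fin 2) (Fin 2) ℂ) layerH gate j *
    Fin.cases (motive := fun _ => Matrix (Fin 2) (Fin 2) ℂ) layerH
      (fun l => (gate l).conjTranspose) j

/-- Average over the uniformly random choices of the trap circuit. -/
def trapAverage {n k : ℕ} (cz : Fin k → CZCycle n) (f : TrapChoice n k → ℝ) : ℝ :=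
  (∑ c ∈ trapChoices cz, f c) / (trapChoices cz).card

/-- The probability that a trap circuit returns an output other than `(0, …, 0)`. -/
def pInc {n k : ℕ} (N : Noise n k) (cz : Fin k → CZCycle n) : ℝ :=
  trapAverage cz fun c =>
    ∑ s ∈ Finset.univ.filter (fun s : Fin n → Fin 2 => s ≠ 0), expDist N cz (trapGates c) s

/-- The single error obtained by commuting all errors of a pattern to the end of the circuit. -/
def mergedError {n k : ℕ} (cz : Fin k → CZCycle n) (U : Gates n k) (P : Pattern n k) : Op n :=
  faultyOp cz U P * (faultyOp cz U (noError n k)).conjTranspose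

/-- The errors of a pattern cancel: the merged error acts as the identity map on states. -/
def Cancels {n k : ℕ} (cz : Fin k → CZCycle n) (U : Gates n k) (P : Pattern n k) : Prop :=
  ∀ ρ : Op n, conjBy (mergedError cz U P) ρ = ρ

open Classical in
/-- The probability that the errors in a trap circuit cancel, given that there are errors
(and `0` if errors have probability zero). -/
def pCanc {n k : ℕ} (N : Noise n k) (cz : Fin k → CZCycle n) : ℝ :=
  (∑ P ∈ Finset.univ.filter (fun P : Pattern n k => P ≠ noError n k),
      patternProb N P * trapAverage cz fun c => if Cancels cz (trapGates c) P then 1 else 0) /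
    pErr N

end

end Accreditation

namespace Accreditation

variable {n k : ℕ}

/-! ### Tensor products -/

/-! The pad turns arbitrary noise into random Pauli errors. Because `cZ` cycles normalise the Pauli
group (`CZCycle.op_mul_pauliOp_mul_op`), a pad string undone after the `cZ` gates acts as one
uniform Pauli string on both sides of the noise map alone, which twirls that map (`pauliTwirl`,
`sum_cyclePad`). The twirl rests on a four-fold identity for sums of Pauli entries
(`Pauli.sum_mat_exchange`). The random `Z` gates dephase the prepared state (`sum_prepPad`), and the
measurement reads only the diagonal, so at both ends only flipped bits matter. Since the pad strings
are independent, averaging proceeds cycle by cycle (`sum_prod_smul_foldLin`), which gives the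
mixture over patterns `expDist_eq`.

Given this mixture, a quantity that is at most 1 on every pattern and nonpositive on the error-free
one has mean at most `pErr` (`sum_patternProb_mul_le`). This bounds both the variation distance and
`pInc`; for the latter, an error-free trap must return zeros. It does, because before each `cZ` one
qubit of every pair is in the state `|0⟩`, so all `cZ` gates act trivially
(`trapCore_noError_mulVec`).

For the remaining bound, trap circuits are Clifford circuits between two layers `H^t`, so a pattern
merges into one Pauli string `R` placed between the layers. Errors at the ends are strings of `I`
and `Y`, which commute with `H^t` up to sign; hence `R` is the same for both values of `t`
(`exists_faultyOp_trapGates`). If `R` is the identity, the pattern cancels. Otherwise `R` flips a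
bit, or has a `Z` that the Hadamard layers turn into an `X`, so some value of `t` gives an incorrect
output with certainty (`one_sub_cancels_le`). As `t` is uniform, a pattern that does not cancel is
detected with probability at least one half: this is the factor 2. -/

theorem sum_prod_fun {ι α R : Type*} [Fintype ι] [DecidableEq ι] [Fintype α] [CommSemiring R]
    (f : ι → α → R) : ∑ p : ι → α, ∏ i, f i (p i) = ∏ i, ∑ a, f i a := by
  rw [Finset.prod_univ_sum, Fintype.piFinset_univ]

theorem tensor_mul (A B : Fin n → Matrix (Fin 2) (Fin 2) ℂ) :
    tensor A * tensor B = tensor fun i => A i * B i := by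
  ext r c
  simp only [tensor, Matrix.mul_apply, Matrix.of_apply, ← Finset.prod_mul_distrib]
  exact sum_prod_fun fun i b => A i (r i) b * B i b (c i)

theorem tensor_conjTranspose (A : Fin n → Matrix (Fin 2) (Fin 2) ℂ) :
    (tensor A).conjTranspose = tensor fun i => (A i).conjTranspose := by
  ext r c
  simp [tensor, Matrix.conjTranspose_apply]

theorem tensor_one : tensor (fun _ : Fin n => 1) = 1 := by
  ext r c
  simp only [tensor, Matrix.of_apply, Matrix.one_apply, Finset.prod_ite_zero, funext_iff]
  simp

theorem tensor_mem_unitaryGroup {A : Fin n → Matrix (Fin 2) (Fin 2) ℂ}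
    (hA : ∀ i, A i ∈ Matrix.unitaryGroup (Fin 2) ℂ) :
    tensor A ∈ Matrix.unitaryGroup (Fin n → Fin 2) ℂ := by
  rw [Matrix.mem_unitaryGroup_iff, Matrix.star_eq_conjTranspose, tensor_conjTranspose, tensor_mul,
    ← tensor_one]
  congr 1
  funext i
  exact Matrix.mem_unitaryGroup_iff.1 (hA i)

/-! ### Pauli strings -/

theorem sum_pauli {M : Type*} [AddCommMonoid M] (f : Pauli → M) :
    ∑ p, f p = f .I + (f .X + (f .Y + f .Z)) := by
  have : (Finset.univ : Finset Pauli) = {.I, .X, .Y, .Z} := rfl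
  rw [this]
  simp

theorem Pauli.mat_conjTranspose (p : Pauli) : p.mat.conjTranspose = p.mat := by
  cases p <;> ext i j <;> fin_cases i <;> fin_cases j <;> simp [Pauli.mat]

theorem Pauli.mat_mul_self (p : Pauli) : p.mat * p.mat = 1 := by
  cases p <;> ext i j <;> fin_cases i <;> fin_cases j <;>
    simp [Pauli.mat]

/-- The nonzero entries of a Pauli operator. -/
noncomputable def Pauli.phase (p : Pauli) (b : Fin 2) : ℂ := p.mat (b + p.flip) b

theorem Pauli.mat_apply (p : Pauli) (a b : Fin 2) :
    p.mat a b = if a = b + p.flip then p.phase b else 0 := by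
  cases p <;> fin_cases a <;> fin_cases b <;> simp [Pauli.mat, Pauli.phase, Pauli.flip]

theorem Pauli.norm_phase (p : Pauli) (b : Fin 2) : ‖p.phase b‖ = 1 := by
  cases p <;> fin_cases b <;> simp [Pauli.mat, Pauli.phase, Pauli.flip]

theorem pauliOp_conjTranspose (P : PauliString n) : (pauliOp P).conjTranspose = pauliOp P := by
  simp [pauliOp, tensor_conjTranspose, Pauli.mat_conjTranspose]

theorem pauliOp_mul_self (P : PauliString n) : pauliOp P * pauliOp P = 1 := by
  simp [pauliOp, tensor_mul, Pauli.mat_mul_self, tensor_one]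

theorem pauliOp_mem_unitaryGroup (P : PauliString n) :
    pauliOp P ∈ Matrix.unitaryGroup (Fin n → Fin 2) ℂ := by
  rw [Matrix.mem_unitaryGroup_iff, Matrix.star_eq_conjTranspose, pauliOp_conjTranspose,
    pauliOp_mul_self]

theorem pauliOp_noError : pauliOp (fun _ : Fin n => Pauli.I) = 1 := by
  rw [pauliOp, ← tensor_one]
  congr 1
  funext i
  ext a b
  fin_cases a <;> fin_cases b <;> simp [Pauli.mat]

theorem pauliOp_apply (P : PauliString n) (r s : Fin n → Fin 2) :
    pauliOp P r s = if r = s + flips P then ∏ i, (P i).phase (s i) else 0 := by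
  simp only [pauliOp, tensor, Matrix.of_apply, Pauli.mat_apply, Finset.prod_ite_zero, funext_iff]
  simp only [Finset.mem_univ, true_imp_iff, Pi.add_apply, flips]
  congr

theorem bits_add_self (s x : Fin n → Fin 2) : s + x + x = s := by
  funext i
  have : ∀ a b : Fin 2, a + b + b = a := by decide
  exact this _ _

theorem bits_eq_add_iff (r s x : Fin n → Fin 2) : r = s + x ↔ s = r + x := by
  constructor <;> rintro rfl <;> rw [bits_add_self]

/-- A Pauli operator is a permutation of basis states with unimodular phases, which drop out on the
diagonal. Thus flipping measured bits is the same as undoing the last pad string, and Paulis with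
equal flips are indistinguishable by the measurement. -/
theorem conjBy_pauliOp_diag (P : PauliString n) (M : Op n) (s : Fin n → Fin 2) :
    conjBy (pauliOp P) M s s = M (s + flips P) (s + flips P) := by
  have h : ∀ j : Fin n → Fin 2, ∏ i, ‖(P i).phase (j i)‖ = 1 := fun j =>
    Finset.prod_eq_one fun i _ => Pauli.norm_phase _ _
  simp only [conjBy, Matrix.mul_apply, Matrix.conjTranspose_apply, pauliOp_apply,
    bits_eq_add_iff s, ite_mul, zero_mul, Finset.sum_ite_eq', Finset.mem_univ, if_true,
    apply_ite star, star_zero, mul_ite, mul_zero]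
  rw [mul_right_comm, Complex.star_def, Complex.mul_conj, Complex.normSq_eq_norm_sq, norm_prod, h]
  simp

/-- The completeness relation of the Pauli operators. -/
theorem sum_pauliOp_mul_pauliOp (a b c d : Fin n → Fin 2) :
    ∑ P : PauliString n, pauliOp P a b * pauliOp P c d =
      if a = d ∧ b = c then 2 ^ n else 0 := by
  have h1 : ∀ a b c d : Fin 2, ∑ p : Pauli, p.mat a b * p.mat c d =
      if a = d ∧ b = c then 2 else 0 := by
    intro a b c d
    simp only [sum_pauli]
    fin_cases a <;> fin_cases b <;> fin_cases c <;> fin_cases d <;> simp [Pauli.mat] <;> norm_num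
  simp only [pauliOp, tensor, Matrix.of_apply, ← Finset.prod_mul_distrib]
  refine (sum_prod_fun fun i (p : Pauli) => p.mat (a i) (b i) * p.mat (c i) (d i)).trans ?_
  simp only [h1, Finset.prod_ite_zero, funext_iff, forall_and]
  simp

/-- The sum of `p ⊗ p ⊗ p ⊗ p` is four times the projector onto the span of the vectors `B ⊗ B`,
with `B` a Bell state. Exchanging factors (1,2) with (3,4) fixes these vectors; the identity
expresses this in entries, with one swap moved from the columns to the rows. -/
theorem Pauli.sum_mat_exchange (a b c d e f g h : Fin 2) :
    ∑ p : Pauli, p.mat a b * p.mat c d * (p.mat e f * p.mat g h) =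
      ∑ p : Pauli, p.mat e b * p.mat c h * (p.mat a f * p.mat g d) := by
  simp only [sum_pauli]
  fin_cases a <;> fin_cases b <;> fin_cases c <;> fin_cases d <;>
  fin_cases e <;> fin_cases f <;> fin_cases g <;> fin_cases h <;> simp [Pauli.mat]

theorem sum_pauliOp_exchange (a b c d e f g h : Fin n → Fin 2) :
    ∑ P : PauliString n, pauliOp P a b * pauliOp P c d * (pauliOp P e f * pauliOp P g h) =
      ∑ P : PauliString n, pauliOp P e b * pauliOp P c h * (pauliOp P a f * pauliOp P g d) := by
  simp only [pauliOp, tensor, Matrix.of_apply, ← Finset.prod_mul_distrib]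
  rw [sum_prod_fun fun i (p : Pauli) => p.mat (a i) (b i) * p.mat (c i) (d i) *
      (p.mat (e i) (f i) * p.mat (g i) (h i)),
    sum_prod_fun fun i (p : Pauli) => p.mat (e i) (b i) * p.mat (c i) (h i) *
      (p.mat (a i) (f i) * p.mat (g i) (d i))]
  exact Finset.prod_congr rfl fun i _ => Pauli.sum_mat_exchange _ _ _ _ _ _ _ _

/-! ### Twirling -/

theorem mul_mul_apply_eq_sum {ι : Type*} [Fintype ι] (A M B : Matrix ι ι ℂ) (a b : ι) :
    (A * M * B) a b = ∑ p : ι × ι, M p.1 p.2 * (A a p.1 * B p.2 b) := by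
  simp only [Matrix.mul_apply, Finset.sum_mul, Fintype.sum_prod_type]
  rw [Finset.sum_comm]
  exact Finset.sum_congr rfl fun _ _ => Finset.sum_congr rfl fun _ _ => by ring

theorem superOp_apply_eq_sum (Φ : SuperOp n) (M : Op n) :
    Φ M = ∑ p : (Fin n → Fin 2) × (Fin n → Fin 2), M p.1 p.2 • Φ (Matrix.single p.1 p.2 1) := by
  conv_lhs => rw [Matrix.matrix_eq_sum_single M]
  simp only [map_sum, Fintype.sum_prod_type]
  refine Finset.sum_congr rfl fun _ _ => Finset.sum_congr rfl fun _ _ => ?_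
  rw [← map_smul, Matrix.smul_single, smul_eq_mul, mul_one]

/-- The unnormalised Pauli twirl of a linear map is a combination of Pauli conjugations. -/
theorem sum_pauliOp_twirl (Φ : SuperOp n) (σ : Op n) :
    ∑ A : PauliString n, pauliOp A * Φ (pauliOp A * σ * pauliOp A) * pauliOp A =
      ∑ P : PauliString n,
        (∑ r, ∑ c, (pauliOp P * Φ (Matrix.single r c 1) * pauliOp P) r c) •
          (pauliOp P * σ * pauliOp P) := by
  ext a b
  -- Both sides are expanded in the same products of an entry of `Φ` and an entry of `σ`; comparing
  -- coefficients leaves exactly the exchange identity.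
  have hl : ∀ A : PauliString n,
      (pauliOp A * Φ (pauliOp A * σ * pauliOp A) * pauliOp A) a b =
        ∑ p : (Fin n → Fin 2) × (Fin n → Fin 2), ∑ q : (Fin n → Fin 2) × (Fin n → Fin 2),
          ∑ t : (Fin n → Fin 2) × (Fin n → Fin 2),
            Φ (Matrix.single q.1 q.2 1) p.1 p.2 * σ t.1 t.2 *
              (pauliOp A a p.1 * pauliOp A p.2 b * (pauliOp A q.1 t.1 * pauliOp A t.2 q.2)) := by
    intro A
    rw [mul_mul_apply_eq_sum]
    refine Finset.sum_congr rfl fun p _ => ?_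
    rw [superOp_apply_eq_sum, Matrix.sum_apply, Finset.sum_mul]
    refine Finset.sum_congr rfl fun q _ => ?_
    rw [Matrix.smul_apply, mul_mul_apply_eq_sum, smul_eq_mul, Finset.sum_mul, Finset.sum_mul]
    exact Finset.sum_congr rfl fun t _ => by ring
  have hr : ∀ P : PauliString n,
      ((∑ r, ∑ c, (pauliOp P * Φ (Matrix.single r c 1) * pauliOp P) r c) •
          (pauliOp P * σ * pauliOp P)) a b =
        ∑ p : (Fin n → Fin 2) × (Fin n → Fin 2), ∑ q : (Fin n → Fin 2) × (Fin n → Fin 2),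
          ∑ t : (Fin n → Fin 2) × (Fin n → Fin 2),
            Φ (Matrix.single q.1 q.2 1) p.1 p.2 * σ t.1 t.2 *
              (pauliOp P q.1 p.1 * pauliOp P p.2 q.2 * (pauliOp P a t.1 * pauliOp P t.2 b)) := by
    intro P
    rw [← Fintype.sum_prod_type' (f := fun r c =>
      (pauliOp P * Φ (Matrix.single r c 1) * pauliOp P) r c), Finset.sum_comm, Finset.sum_smul,
      Matrix.sum_apply]
    refine Finset.sum_congr rfl fun q _ => ?_
    rw [mul_mul_apply_eq_sum, Finset.sum_smul, Matrix.sum_apply]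
    refine Finset.sum_congr rfl fun p _ => ?_
    rw [Matrix.smul_apply, mul_mul_apply_eq_sum, smul_eq_mul, Finset.mul_sum]
    exact Finset.sum_congr rfl fun t _ => by ring
  simp only [Matrix.sum_apply, hl, hr]
  rw [Finset.sum_comm, eq_comm, Finset.sum_comm]
  refine Finset.sum_congr rfl fun p _ => ?_
  rw [Finset.sum_comm, eq_comm, Finset.sum_comm]
  refine Finset.sum_congr rfl fun q _ => ?_
  rw [Finset.sum_comm, eq_comm, Finset.sum_comm]
  refine Finset.sum_congr rfl fun t _ => ?_
  rw [← Finset.mul_sum, ← Finset.mul_sum, sum_pauliOp_exchange]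

open scoped ComplexOrder in
-- The sum is a diagonal matrix element of the Choi matrix: `v` is the unnormalised maximally
-- entangled vector, with the ancilla enumerated through `e`, and the test vector is the
-- vectorisation of `P`.
theorem twirlTrace_nonneg {Φ : SuperOp n} (hΦ : IsCPTP Φ) (P : PauliString n) :
    0 ≤ ∑ r, ∑ c, ((pauliOp P).conjTranspose * Φ (Matrix.single r c 1) * pauliOp P) r c := by
  let e := (Fintype.equivFin (Fin n → Fin 2)).symm
  let v : Fin (Fintype.card (Fin n → Fin 2)) × (Fin n → Fin 2) → ℂ :=
    fun x => if x.2 = e x.1 then 1 else 0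
  have h := (hΦ.completelyPositive _ _
    (Matrix.posSemidef_vecMulVec_self_star v)).dotProduct_mulVec_nonneg fun x => pauliOp P x.2 (e x.1)
  have hM : ∀ x y : Fin (Fintype.card (Fin n → Fin 2)),
      (Matrix.of fun r c => Matrix.vecMulVec v (star v) (x, r) (y, c)) =
        (Matrix.single (e x) (e y) 1 : Op n) := by
    intro x y
    ext r c
    simp only [Matrix.of_apply, Matrix.vecMulVec_apply, v, Pi.star_apply, Matrix.single_apply]
    split_ifs <;> simp_all
  refine h.trans_eq ?_
  simp only [dotProduct, Matrix.mulVec, ampliation, Matrix.of_apply, hM, Pi.star_apply,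
    Fintype.sum_prod_type, Finset.mul_sum]
  refine Eq.trans ?_ (e.sum_comp _)
  refine Finset.sum_congr rfl fun x _ => ?_
  rw [Finset.sum_comm]
  refine Eq.trans ?_ (e.sum_comp _)
  refine Finset.sum_congr rfl fun y _ => ?_
  rw [mul_mul_apply_eq_sum, Fintype.sum_prod_type]
  refine Finset.sum_congr rfl fun r _ => Finset.sum_congr rfl fun c _ => ?_
  rw [Matrix.conjTranspose_apply]
  ring

open scoped ComplexOrder in
theorem ofReal_twirlRate {Φ : SuperOp n} (hΦ : IsCPTP Φ) (P : PauliString n) :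
    (twirlRate Φ P : ℂ) =
      (∑ r, ∑ c, (pauliOp P * Φ (Matrix.single r c 1) * pauliOp P) r c) / 4 ^ n := by
  have h := twirlTrace_nonneg hΦ P
  rw [pauliOp_conjTranspose] at h
  rw [twirlRate, pauliOp_conjTranspose]
  apply Complex.ext
  · simp
  · rw [Complex.ofReal_im, show (4 : ℂ) ^ n = ((4 ^ n : ℝ) : ℂ) by push_cast; rfl,
      Complex.div_ofReal_im, ← (Complex.nonneg_iff.1 h).2, zero_div]

open scoped ComplexOrder in
theorem twirlRate_nonneg {Φ : SuperOp n} (hΦ : IsCPTP Φ) (P : PauliString n) :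
    0 ≤ twirlRate Φ P := by
  rw [twirlRate, show (4 : ℂ) ^ n = ((4 ^ n : ℝ) : ℂ) by push_cast; rfl, Complex.div_ofReal_re]
  exact div_nonneg (Complex.nonneg_iff.1 (twirlTrace_nonneg hΦ P)).1 (by positivity)

/-- By completeness the sum over `P` replaces each term by `2 ^ n` times a trace of `Φ` if `r = c`,
and by zero otherwise. Trace preservation then yields `2 ^ n` for each of the `2 ^ n` basis states.
-/
theorem sum_twirlRate {Φ : SuperOp n} (hΦ : IsCPTP Φ) : ∑ P, twirlRate Φ P = 1 := by
  have key : ∑ P : PauliString n,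
      ∑ r, ∑ c, (pauliOp P * Φ (Matrix.single r c 1) * pauliOp P) r c = 4 ^ n := by
    rw [Finset.sum_comm]
    have h : ∀ r : Fin n → Fin 2,
        ∑ P : PauliString n, ∑ c, (pauliOp P * Φ (Matrix.single r c 1) * pauliOp P) r c = 2 ^ n := by
      intro r
      rw [Finset.sum_comm]
      have h' : ∀ c, ∑ P : PauliString n, (pauliOp P * Φ (Matrix.single r c 1) * pauliOp P) r c =
          if r = c then 2 ^ n else 0 := by
        intro c
        simp only [mul_mul_apply_eq_sum]
        rw [Finset.sum_comm]
        simp only [← Finset.mul_sum, sum_pauliOp_mul_pauliOp, Fintype.sum_prod_type]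
        by_cases hrc : r = c
        · subst hrc
          have := hΦ.tracePreserving (Matrix.single r r 1)
          simp only [Matrix.trace, Matrix.diag_apply] at this
          simp [← Finset.sum_mul, this, Matrix.single_apply]
        · simp [hrc]
      simp [h']
    simp only [h]
    simp [← mul_pow]
    norm_num
  have : ((∑ P, twirlRate Φ P : ℝ) : ℂ) = 1 := by
    push_cast
    simp only [ofReal_twirlRate hΦ]
    rw [← Finset.sum_div, key, div_self (by simp)]
  exact_mod_cast this

/-- The Pauli twirl of a quantum channel is a mixture of Pauli conjugations. -/
theorem pauliTwirl {Φ : SuperOp n} (hΦ : IsCPTP Φ) (σ : Op n) :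
    ∑ A : PauliString n,
        ((4 : ℂ) ^ n)⁻¹ • conjBy (pauliOp A) (Φ (conjBy (pauliOp A) σ)) =
      ∑ P : PauliString n, (twirlRate Φ P : ℂ) • conjBy (pauliOp P) σ := by
  simp only [conjBy, pauliOp_conjTranspose]
  rw [← Finset.smul_sum, sum_pauliOp_twirl, Finset.smul_sum]
  refine Finset.sum_congr rfl fun P _ => ?_
  rw [ofReal_twirlRate hΦ, smul_smul, div_eq_inv_mul]

/-! ### Errors of preparation and measurement -/

open Classical in
theorem sum_isFlipString {M : Type*} [AddCommMonoid M] (f : (Fin n → Fin 2) → M) :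
    ∑ P : PauliString n, (if IsFlipString P then f (flips P) else 0) = ∑ a, f a := by
  rw [← Finset.sum_filter]
  refine Finset.sum_bij' (fun P _ => flips P)
    (fun a _ i => if a i = 1 then Pauli.Y else Pauli.I) ?_ ?_ ?_ ?_ ?_
  · simp
  · intro a _
    refine Finset.mem_filter.2 ⟨Finset.mem_univ _, fun i => ?_⟩
    dsimp only
    split_ifs <;> simp
  · intro P hP
    funext i
    rcases (Finset.mem_filter.1 hP).2 i with h | h <;> simp [flips, Pauli.flip, h]
  · intro a _
    funext i
    have : ∀ b : Fin 2, (if b = 1 then Pauli.Y else Pauli.I).flip = b := by decide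
    exact this _
  · simp

open scoped ComplexOrder in
theorem prep_posSemidef {Φ : SuperOp n} (hΦ : IsCPTP Φ) : (Φ (zeroState n)).PosSemidef := by
  have h0 : zeroState n = Matrix.vecMulVec (Pi.single 0 1) (star (Pi.single 0 1)) := by
    rw [zeroState, ← Pi.single_star, star_one, Matrix.single_eq_single_vecMulVec_single]
  have hM : (Matrix.of fun x y => zeroState n x.2 y.2 :
      Matrix (Fin 1 × (Fin n → Fin 2)) (Fin 1 × (Fin n → Fin 2)) ℂ).PosSemidef := by
    have := (Matrix.posSemidef_vecMulVec_self_star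
      (Pi.single 0 1 : (Fin n → Fin 2) → ℂ)).submatrix
        (Prod.snd : Fin 1 × (Fin n → Fin 2) → Fin n → Fin 2)
    rw [← h0] at this
    exact this
  exact (hΦ.completelyPositive 1 _ hM).submatrix fun r => (0, r)

open scoped ComplexOrder in
theorem prepRate_nonneg {Φ : SuperOp n} (hΦ : IsCPTP Φ) (P : PauliString n) :
    0 ≤ prepRate Φ P := by
  rw [prepRate]
  split_ifs
  · exact (Complex.nonneg_iff.1 (prep_posSemidef hΦ).diag_nonneg).1
  · rfl

theorem sum_prepRate {Φ : SuperOp n} (hΦ : IsCPTP Φ) : ∑ P, prepRate Φ P = 1 := by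
  simp only [prepRate]
  rw [sum_isFlipString fun a => (Φ (zeroState n) a a).re, ← Complex.re_sum]
  have := hΦ.tracePreserving (zeroState n)
  simp only [Matrix.trace, Matrix.diag_apply] at this
  rw [this]
  simp [zeroState, Matrix.single_apply]

theorem measRate_nonneg {Φ : SuperOp n} (hΦ : IsCPTP Φ) (P : PauliString n) :
    0 ≤ measRate Φ P := by
  rw [measRate]
  split_ifs
  · exact Finset.sum_nonneg fun P' _ => by split_ifs <;> simp [twirlRate_nonneg hΦ]
  · rfl

/-- Each class of Pauli strings with the same flips contains exactly one string of `I` and `Y`, so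
collecting weights on it does not affect averages of functions of the flips. -/
theorem sum_measRate_smul {M : Type*} [AddCommMonoid M] [Module ℝ M] (Φ : SuperOp n)
    (f : (Fin n → Fin 2) → M) :
    ∑ P, measRate Φ P • f (flips P) = ∑ P, twirlRate Φ P • f (flips P) := by
  classical
  simp only [measRate, ite_smul, zero_smul]
  rw [sum_isFlipString fun a => (∑ P', if flips P' = a then twirlRate Φ P' else 0) • f a]
  simp only [Finset.sum_smul, ite_smul, zero_smul]
  rw [Finset.sum_comm]
  simp

theorem errorRate_zero (N : Noise n k) (P : PauliString n) :
    errorRate N 0 P = prepRate N.prep P := rfl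

theorem errorRate_succ_castSucc (N : Noise n k) (j : Fin k) (P : PauliString n) :
    errorRate N j.castSucc.succ P = twirlRate (N.cycle j.castSucc) P := by
  simp [errorRate, (Fin.castSucc_lt_last j).ne]

theorem errorRate_succ_last (N : Noise n k) (P : PauliString n) :
    errorRate N (Fin.last k).succ P = measRate (N.cycle (Fin.last k)) P :=
  if_pos rfl

theorem errorRate_nonneg (N : Noise n k) (j : Fin (k + 2)) (P : PauliString n) :
    0 ≤ errorRate N j P := by
  refine Fin.cases ?_ (fun i => Fin.lastCases ?_ (fun i => ?_) i) j
  · exact prepRate_nonneg N.prep_isCPTP P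
  · rw [errorRate_succ_last]
    exact measRate_nonneg (N.cycle_isCPTP _) P
  · rw [errorRate_succ_castSucc]
    exact twirlRate_nonneg (N.cycle_isCPTP _) P

theorem sum_errorRate (N : Noise n k) (j : Fin (k + 2)) : ∑ P, errorRate N j P = 1 := by
  refine Fin.cases ?_ (fun i => Fin.lastCases ?_ (fun i => ?_) i) j
  · exact sum_prepRate N.prep_isCPTP
  · have h := sum_measRate_smul (N.cycle (Fin.last k)) fun _ => (1 : ℝ)
    simp only [smul_eq_mul, mul_one] at h
    simp only [errorRate_succ_last, h]
    exact sum_twirlRate (N.cycle_isCPTP _)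
  · simp only [errorRate_succ_castSucc]
    exact sum_twirlRate (N.cycle_isCPTP _)

/-! ### Conjugation -/

theorem conjBy_conjBy (A B ρ : Op n) : conjBy A (conjBy B ρ) = conjBy (A * B) ρ := by
  simp only [conjBy, Matrix.conjTranspose_mul, Matrix.mul_assoc]

theorem conjBy_smul_left {v : ℂ} (hv : ‖v‖ = 1) (A ρ : Op n) :
    conjBy (v • A) ρ = conjBy A ρ := by
  have : star v * v = 1 := by
    rw [Complex.star_def, Complex.conj_mul', hv]
    simp
  simp only [conjBy, Matrix.conjTranspose_smul, Matrix.smul_mul, Matrix.mul_smul, smul_smul, this,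
    one_smul]

/-- Conjugation, as a linear map. -/
noncomputable def conjLin (V : Op n) : SuperOp n where
  toFun := conjBy V
  map_add' := fun _ _ => by simp only [conjBy, Matrix.mul_add, Matrix.add_mul]
  map_smul' := fun _ _ => by simp [conjBy]

theorem conjLin_apply (V ρ : Op n) : conjLin V ρ = conjBy V ρ := rfl

theorem conjBy_zeroState_diag (V : Op n) (s : Fin n → Fin 2) :
    conjBy V (zeroState n) s s = ((‖V s 0‖ ^ 2 : ℝ) : ℂ) := by
  rw [conjBy, mul_mul_apply_eq_sum, Fintype.sum_eq_single (0, 0)]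
  · simp [zeroState, Complex.mul_conj, Complex.normSq_eq_norm_sq]
  · rintro ⟨a, b⟩ h
    rw [zeroState, Matrix.single_apply_of_ne, zero_mul]
    rintro ⟨rfl, rfl⟩
    exact h rfl

/-! ### Iterated linear maps -/

section Foldl

variable {E α : Type*} [AddCommMonoid E] [Module ℂ E]

/-- The composition of a finite sequence of linear maps. -/
noncomputable def foldLin (F : Fin k → E →ₗ[ℂ] E) : E →ₗ[ℂ] E :=
  Fin.foldl k (fun G j => F j ∘ₗ G) LinearMap.id

theorem foldLin_apply (F : Fin k → E →ₗ[ℂ] E) (x : E) :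
    foldLin F x = Fin.foldl k (fun x j => F j x) x := by
  rw [foldLin]
  induction k with
  | zero => simp
  | succ k ih => simp only [Fin.foldl_succ_last, LinearMap.comp_apply, ih]

theorem foldLin_succ (F : Fin (k + 1) → E →ₗ[ℂ] E) (x : E) :
    foldLin F x = F (Fin.last k) (foldLin (fun j => F j.castSucc) x) := by
  simp only [foldLin_apply, Fin.foldl_succ_last]

theorem sum_snoc {M : Type*} [Fintype α] [AddCommMonoid M] (f : (Fin (k + 1) → α) → M) :
    ∑ A, f A = ∑ A : Fin k → α, ∑ a, f (Fin.snoc (α := fun _ => α) A a) := by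
  rw [← (Fin.snocEquiv fun _ : Fin (k + 1) => α).sum_comp, Fintype.sum_prod_type, Finset.sum_comm]
  rfl

theorem sum_cons {M : Type*} [Fintype α] [AddCommMonoid M] (f : (Fin (k + 1) → α) → M) :
    ∑ A, f A = ∑ a, ∑ A : Fin k → α, f (Fin.cons (α := fun _ => α) a A) := by
  rw [← (Fin.consEquiv fun _ : Fin (k + 1) => α).sum_comp, Fintype.sum_prod_type]
  rfl

/-- Composition is multilinear, so independent choices can be averaged cycle by cycle. It serves
twice: to average the pad, and to expand twirled noise into patterns. -/
theorem sum_prod_smul_foldLin [Fintype α] (w : Fin k → α → ℂ) (f : Fin k → α → E →ₗ[ℂ] E) (x : E) :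
    ∑ A : Fin k → α, (∏ j, w j (A j)) • foldLin (fun j => f j (A j)) x =
      foldLin (fun j => ∑ a, w j a • f j a) x := by
  induction k with
  | zero => simp [foldLin_apply]
  | succ k ih =>
    rw [sum_snoc, foldLin_succ, ← ih, Finset.sum_comm, LinearMap.sum_apply]
    refine Finset.sum_congr rfl fun a _ => ?_
    rw [LinearMap.smul_apply, map_sum, Finset.smul_sum]
    refine Finset.sum_congr rfl fun A _ => ?_
    rw [foldLin_succ, Fin.prod_univ_castSucc, map_smul, smul_smul, mul_comm]
    simp only [Fin.snoc_castSucc, Fin.snoc_last]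

end Foldl

/-! ### Commuting Pauli strings through controlled-`Z` gates -/

/-- The diagonal entries of the controlled-`Z` gate. -/
noncomputable def bitSign (a b : Fin 2) : ℂ := if a = 1 ∧ b = 1 then -1 else 1

theorem norm_bitSign (a b : Fin 2) : ‖bitSign a b‖ = 1 := by
  rw [bitSign]
  split_ifs <;> simp

theorem bitSign_mul_self (a b : Fin 2) : bitSign a b * bitSign a b = 1 := by
  rw [bitSign]
  split_ifs <;> simp

/-- In exponents of `-1` this is `(a + x)(b + y) + ab = xy + ay + bx` modulo 2. -/
theorem bitSign_add_mul (a b x y : Fin 2) :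
    bitSign (a + x) (b + y) * bitSign a b = bitSign x y * (bitSign a y * bitSign b x) := by
  fin_cases a <;> fin_cases b <;> fin_cases x <;> fin_cases y <;> simp [bitSign]

/-- Multiplication by `Z ^ b`, up to a phase. -/
def Pauli.mulZ (p : Pauli) (b : Fin 2) : Pauli :=
  if b = 0 then p else
    match p with
    | .I => .Z
    | .X => .Y
    | .Y => .X
    | .Z => .I

theorem Pauli.flip_mulZ (p : Pauli) (b : Fin 2) : (p.mulZ b).flip = p.flip := by
  revert p b
  decide

theorem Pauli.mulZ_mulZ (p : Pauli) (b : Fin 2) : (p.mulZ b).mulZ b = p := by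
  revert p b
  decide

theorem Pauli.mat_mulZ (p : Pauli) (b : Fin 2) :
    ∃ u : ℂ, ‖u‖ = 1 ∧ ∀ a c, p.mat a c * bitSign c b = u * (p.mulZ b).mat a c := by
  cases p <;> fin_cases b
  · exact ⟨1, by simp, fun a c => by simp [mulZ, bitSign]⟩
  · exact ⟨1, by simp, fun a c => by
      fin_cases a <;> fin_cases c <;> simp [mulZ, bitSign, mat]⟩
  · exact ⟨1, by simp, fun a c => by simp [mulZ, bitSign]⟩
  · exact ⟨-Complex.I, by simp, fun a c => by
      fin_cases a <;> fin_cases c <;> simp [mulZ, bitSign, mat]⟩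
  · exact ⟨1, by simp, fun a c => by simp [mulZ, bitSign]⟩
  · exact ⟨Complex.I, by simp, fun a c => by
      fin_cases a <;> fin_cases c <;> simp [mulZ, bitSign, mat]⟩
  · exact ⟨1, by simp, fun a c => by simp [mulZ, bitSign]⟩
  · exact ⟨1, by simp, fun a c => by
      fin_cases a <;> fin_cases c <;> simp [mulZ, bitSign, mat]⟩

namespace CZCycle

/-- The diagonal of the unitary of a cycle of controlled-`Z` gates. -/
noncomputable def sign (c : CZCycle n) (s : Fin n → Fin 2) : ℂ :=
  ∏ i, if i < c.partner i then bitSign (s i) (s (c.partner i)) else 1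

theorem op_eq (c : CZCycle n) : c.op = Matrix.diagonal c.sign := by
  rw [op]
  congr 1
  funext s
  refine Finset.prod_congr rfl fun i _ => ?_
  simp only [bitSign, ite_and]

theorem norm_sign (c : CZCycle n) (s : Fin n → Fin 2) : ‖c.sign s‖ = 1 := by
  rw [sign, norm_prod]
  refine Finset.prod_eq_one fun i _ => ?_
  split_ifs <;> simp [norm_bitSign]

theorem op_mul_self (c : CZCycle n) : c.op * c.op = 1 := by
  rw [op_eq, Matrix.diagonal_mul_diagonal, ← Matrix.diagonal_one]
  congr 1
  funext s
  rw [sign, ← Finset.prod_mul_distrib]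
  refine Finset.prod_eq_one fun i _ => ?_
  split_ifs <;> simp [bitSign_mul_self]

theorem op_conjTranspose (c : CZCycle n) : c.op.conjTranspose = c.op := by
  rw [op, Matrix.diagonal_conjTranspose]
  congr 1
  funext s
  simp only [Pi.star_apply, star_prod]
  refine Finset.prod_congr rfl fun i _ => ?_
  split_ifs <;> simp

theorem op_mem_unitaryGroup (c : CZCycle n) : c.op ∈ Matrix.unitaryGroup (Fin n → Fin 2) ℂ := by
  rw [Matrix.mem_unitaryGroup_iff, Matrix.star_eq_conjTranspose, op_conjTranspose, op_mul_self]

theorem sign_add_mul_sign (c : CZCycle n) (s x : Fin n → Fin 2) :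
    c.sign (s + x) * c.sign s =
      c.sign x * ∏ i, bitSign (s i) (if c.partner i = i then 0 else x (c.partner i)) := by
  have h : ∏ i, bitSign (s i) (if c.partner i = i then 0 else x (c.partner i)) =
      ∏ i, if i < c.partner i then
        bitSign (s i) (x (c.partner i)) * bitSign (s (c.partner i)) (x i) else 1 := by
    -- The sign counts each pair once, at its smaller qubit, while the induced `Z` gates sit on both
    -- qubits; reindexing by the partner involution moves the second factor to the larger one.
    have h1 : ∏ i, (if i < c.partner i then bitSign (s (c.partner i)) (x i) else 1) =
        ∏ i, if c.partner i < i then bitSign (s i) (x (c.partner i)) else 1 := by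
      refine (Equiv.prod_comp c.involutive.toPerm _).symm.trans ?_
      refine Finset.prod_congr rfl fun i _ => ?_
      simp only [Function.Involutive.coe_toPerm, c.involutive i]
    have h2 : ∀ i, (if i < c.partner i then
        bitSign (s i) (x (c.partner i)) * bitSign (s (c.partner i)) (x i) else 1) =
        (if i < c.partner i then bitSign (s i) (x (c.partner i)) else 1) *
          (if i < c.partner i then bitSign (s (c.partner i)) (x i) else 1) := by
      intro i
      split_ifs <;> simp
    simp only [h2]
    rw [Finset.prod_mul_distrib, h1, ← Finset.prod_mul_distrib]
    refine Finset.prod_congr rfl fun i _ => ?_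
    rcases lt_trichotomy i (c.partner i) with hi | hi | hi
    · simp [hi, hi.ne', hi.not_gt]
    · simp [← hi, bitSign]
    · simp [hi, hi.ne, hi.not_gt]
  rw [h, sign, sign, sign, ← Finset.prod_mul_distrib, ← Finset.prod_mul_distrib]
  refine Finset.prod_congr rfl fun i _ => ?_
  split_ifs
  · exact bitSign_add_mul _ _ _ _
  · simp

/-- The Pauli string `cZ P cZ`, up to a phase. -/
def act (c : CZCycle n) (P : PauliString n) : PauliString n := fun i =>
  (P i).mulZ (if c.partner i = i then 0 else flips P (c.partner i))

theorem act_involutive (c : CZCycle n) : Function.Involutive c.act := by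
  intro P
  have : flips (c.act P) = flips P := funext fun i => Pauli.flip_mulZ _ _
  funext i
  rw [act, this, act, Pauli.mulZ_mulZ]

/-- The nonzero entries of `P` sit at `(s + x, s)`, with `x` the flips, and gain the factor `sign (s
+ x) * sign s`. As a function of `s` this is a phase times the diagonal of `Z` gates on the partners
of flipped qubits. -/
theorem op_mul_pauliOp_mul_op (c : CZCycle n) (P : PauliString n) :
    ∃ v : ℂ, ‖v‖ = 1 ∧ c.op * pauliOp P * c.op = v • pauliOp (c.act P) := by
  choose u hu hP using fun i =>
    (P i).mat_mulZ (if c.partner i = i then 0 else flips P (c.partner i))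
  refine ⟨c.sign (flips P) * ∏ i, u i, by simp [norm_sign, norm_prod, hu], ?_⟩
  ext r s
  have hact : pauliOp P r s * ∏ i, bitSign (s i) (if c.partner i = i then 0 else
      flips P (c.partner i)) = (∏ i, u i) * pauliOp (c.act P) r s := by
    simp only [pauliOp, tensor, Matrix.of_apply, ← Finset.prod_mul_distrib]
    exact Finset.prod_congr rfl fun i _ => hP i _ _
  rw [op_eq, Matrix.mul_diagonal, Matrix.diagonal_mul, Matrix.smul_apply, smul_eq_mul]
  by_cases hr : r = s + flips P
  · have := c.sign_add_mul_sign s (flips P)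
    rw [← hr] at this
    linear_combination pauliOp P r s * this + c.sign (flips P) * hact
  · have h0 : pauliOp P r s = 0 := by rw [pauliOp_apply, if_neg hr]
    rw [h0] at hact ⊢
    linear_combination c.sign (flips P) * hact

end CZCycle

/-! ### The output distribution with the one-time pad -/

/-- Dephasing: the entry at `(r, c)` is multiplied by the average over `g` of a product of two sign
characters, which vanishes unless `r = c`. -/
theorem sum_prepPad (ρ : Op n) :
    ∑ g : Fin n → Fin 2, ((2 : ℂ) ^ n)⁻¹ •
        conjBy (pauliOp fun i => if g i = 1 then Pauli.Z else Pauli.I) ρ =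
      Matrix.diagonal fun a => ρ a a := by
  have h1 : ∀ (a c : Fin 2) (b : Fin 2), (if b = 1 then Pauli.Z else Pauli.I).mat a c =
      if a = c then bitSign b c else 0 := by
    intro a c b
    fin_cases a <;> fin_cases b <;> fin_cases c <;> simp [Pauli.mat, bitSign]
  have h2 : ∀ a c : Fin 2, ∑ b, bitSign b a * bitSign b c = if a = c then 2 else 0 := by
    intro a c
    fin_cases a <;> fin_cases c <;> (simp [bitSign]; try norm_num)
  have hZ : ∀ g : Fin n → Fin 2, (pauliOp fun i => if g i = 1 then Pauli.Z else Pauli.I) =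
      Matrix.diagonal fun s => ∏ i, bitSign (g i) (s i) := by
    intro g
    ext r s
    simp only [pauliOp, tensor, Matrix.of_apply, h1, Finset.prod_ite_zero, Matrix.diagonal_apply,
      funext_iff, Finset.mem_univ, true_imp_iff]
    split_ifs with h
    · exact Finset.prod_congr rfl fun i _ => by rw [h i]
    · rfl
  ext r c
  have hentry : ∀ g : Fin n → Fin 2,
      conjBy (pauliOp fun i => if g i = 1 then Pauli.Z else Pauli.I) ρ r c =
        (∏ i, bitSign (g i) (r i) * bitSign (g i) (c i)) * ρ r c := by
    intro g
    rw [conjBy, pauliOp_conjTranspose, hZ, Matrix.mul_diagonal, Matrix.diagonal_mul,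
      Finset.prod_mul_distrib]
    ring
  simp only [Matrix.sum_apply, Matrix.smul_apply, hentry, smul_eq_mul]
  rw [← Finset.mul_sum, ← Finset.sum_mul,
    sum_prod_fun fun i b => bitSign b (r i) * bitSign b (c i)]
  simp only [h2, Finset.prod_ite_zero, Matrix.diagonal_apply]
  by_cases h : r = c
  · subst h
    simp
  · rw [if_neg h, if_neg]
    · simp
    · simpa [funext_iff] using h

theorem conjBy_pauliOp_zeroState (P : PauliString n) :
    conjBy (pauliOp P) (zeroState n) = Matrix.single (flips P) (flips P) 1 := by
  have h : ∏ i, ‖(P i).phase 0‖ = 1 := Finset.prod_eq_one fun i _ => Pauli.norm_phase _ _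
  ext r c
  rw [conjBy, mul_mul_apply_eq_sum, Fintype.sum_eq_single (0, 0)]
  · rw [Matrix.conjTranspose_apply, pauliOp_apply, pauliOp_apply]
    simp only [zero_add, Matrix.single_apply, zeroState]
    by_cases hr : r = flips P <;> by_cases hc : c = flips P
    · simp [hr, hc, ← Finset.prod_mul_distrib, Complex.mul_conj, Complex.normSq_eq_norm_sq,
        Pauli.norm_phase]
    · simp [hr, hc, Ne.symm hc]
    · simp [hr, Ne.symm hr]
    · simp [hr, Ne.symm hr]
  · rintro ⟨a, b⟩ h
    rw [zeroState, Matrix.single_apply_of_ne, zero_mul]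
    rintro ⟨rfl, rfl⟩
    exact h rfl

open scoped ComplexOrder in
theorem sum_prepRate_conjBy {Φ : SuperOp n} (hΦ : IsCPTP Φ) :
    ∑ P : PauliString n, (prepRate Φ P : ℂ) • conjBy (pauliOp P) (zeroState n) =
      Matrix.diagonal fun a => Φ (zeroState n) a a := by
  classical
  have hre : ∀ a, ((Φ (zeroState n) a a).re : ℂ) = Φ (zeroState n) a a := fun a =>
    Complex.ext (by simp)
      (by simpa using (Complex.nonneg_iff.1 ((prep_posSemidef hΦ).diag_nonneg (i := a))).2)
  have h : ∀ P : PauliString n, (prepRate Φ P : ℂ) • conjBy (pauliOp P) (zeroState n) =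
      if IsFlipString P then
        Matrix.single (flips P) (flips P) (Φ (zeroState n) (flips P) (flips P)) else 0 := by
    intro P
    rw [conjBy_pauliOp_zeroState, prepRate]
    split_ifs
    · rw [hre, Matrix.smul_single, smul_eq_mul, mul_one]
    · simp
  simp only [h]
  rw [sum_isFlipString fun a => Matrix.single a a (Φ (zeroState n) a a)]
  ext r c
  simp only [Matrix.sum_apply, Matrix.single_apply, Matrix.diagonal_apply]
  by_cases hrc : r = c
  · subst hrc
    simp
  · rw [if_neg hrc]
    exact Finset.sum_eq_zero fun a _ => if_neg fun ⟨h1, h2⟩ => hrc (h1.symm.trans h2)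

/-- The one-time pad around a noisy cycle of controlled-`Z` gates twirls the noise. -/
theorem sum_cyclePad {Φ : SuperOp n} (hΦ : IsCPTP Φ) (c : CZCycle n) (σ : Op n) :
    ∑ A : PauliString n, ((4 : ℂ) ^ n)⁻¹ •
        conjBy (c.op * pauliOp A * c.op) (Φ (conjBy c.op (conjBy (pauliOp A) σ))) =
      ∑ P : PauliString n, (twirlRate Φ P : ℂ) • conjBy (pauliOp P) (conjBy c.op σ) := by
  rw [← pauliTwirl hΦ]
  -- The string seen by the noise behind the `cZ` gates is `c.act A`; it is uniform like `A` because
  -- `act` is a bijection.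
  refine Eq.trans ?_ (Equiv.sum_comp c.act_involutive.toPerm _)
  refine Finset.sum_congr rfl fun A _ => ?_
  rw [Function.Involutive.coe_toPerm]
  obtain ⟨v, hv, h⟩ := c.op_mul_pauliOp_mul_op A
  have h' : c.op * pauliOp A = v • (pauliOp (c.act A) * c.op) := by
    rw [← Matrix.smul_mul, ← h, Matrix.mul_assoc, c.op_mul_self, Matrix.mul_one]
  rw [conjBy_conjBy c.op, h, h', conjBy_smul_left hv, conjBy_smul_left hv, ← conjBy_conjBy]

/-- A padded noisy run of a cycle of one-qubit gates and of the controlled-`Z` gates after it. -/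
noncomputable def noisyCycle (Φ : SuperOp n) (c : CZCycle n) (V : Op n) (A : PauliString n) :
    SuperOp n :=
  conjLin (c.op * pauliOp A * c.op) ∘ₗ Φ ∘ₗ conjLin c.op ∘ₗ conjLin (pauliOp A) ∘ₗ conjLin V

theorem sum_noisyCycle {Φ : SuperOp n} (hΦ : IsCPTP Φ) (c : CZCycle n) (V : Op n) :
    ∑ A, ((4 : ℂ) ^ n)⁻¹ • noisyCycle Φ c V A =
      ∑ P, (twirlRate Φ P : ℂ) • conjLin (pauliOp P * c.op * V) := by
  refine LinearMap.ext fun ρ => ?_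
  simp only [LinearMap.sum_apply, LinearMap.smul_apply, noisyCycle, LinearMap.comp_apply,
    conjLin_apply]
  rw [sum_cyclePad hΦ]
  simp only [conjBy_conjBy, Matrix.mul_assoc]

theorem noisyState_snoc (N : Noise n k) (cz : Fin k → CZCycle n) (U : Gates n k)
    (g : Fin n → Fin 2) (A : Fin k → PauliString n) (a : PauliString n) :
    noisyState N cz U g (Fin.snoc (α := fun _ => PauliString n) A a) =
      N.cycle (Fin.last k) (conjBy (pauliOp a) (conjBy (tensor (U (Fin.last k)))
        (foldLin (fun j => noisyCycle (N.cycle j.castSucc) (cz j) (tensor (U j.castSucc)) (A j))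
          (conjBy (pauliOp fun i => if g i = 1 then Pauli.Z else Pauli.I)
            (N.prep (zeroState n)))))) := by
  rw [foldLin_apply]
  simp only [noisyState, Fin.snoc_last, Fin.snoc_castSucc]
  rfl

/-- A cycle of one-qubit gates and controlled-`Z` gates followed by twirled noise. -/
noncomputable def twirledCycle (Φ : SuperOp n) (c : CZCycle n) (V : Op n) : SuperOp n :=
  ∑ P, (twirlRate Φ P : ℂ) • conjLin (pauliOp P * c.op * V)

/-- The state before the last cycle of one-qubit gates, averaged over the one-time pad. -/
noncomputable def twirledState (N : Noise n k) (cz : Fin k → CZCycle n) (U : Gates n k) : Op n :=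
  foldLin (fun j => twirledCycle (N.cycle j.castSucc) (cz j) (tensor (U j.castSucc)))
    (Matrix.diagonal fun a => N.prep (zeroState n) a a)

theorem sum_smul_map {ι E F : Type*} [Fintype ι] [AddCommMonoid E] [Module ℂ E] [AddCommMonoid F]
    [Module ℂ F] (L : E →ₗ[ℂ] F) (w : ℂ) (x : ι → E) :
    ∑ i, w • L (x i) = L (∑ i, w • x i) := by
  simp only [map_sum, map_smul]

/-- The last pad string `a` is kept fixed, since it is undone only on the measured bits; its average
gives the final twirl in `expDist_eq`. -/
theorem sum_noisyState (N : Noise n k) (cz : Fin k → CZCycle n) (U : Gates n k)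
    (a : PauliString n) :
    ∑ g, ((2 : ℂ) ^ n)⁻¹ • ∑ A : Fin k → PauliString n, (((4 : ℂ) ^ n)⁻¹) ^ k •
        noisyState N cz U g (Fin.snoc (α := fun _ => PauliString n) A a) =
      N.cycle (Fin.last k) (conjBy (pauliOp a) (conjBy (tensor (U (Fin.last k)))
        (twirledState N cz U))) := by
  have h := fun ρ => sum_prod_smul_foldLin (fun (_ : Fin k) (_ : PauliString n) => ((4 : ℂ) ^ n)⁻¹)
    (fun j => noisyCycle (N.cycle j.castSucc) (cz j) (tensor (U j.castSucc))) ρ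
  simp only [sum_noisyCycle (N.cycle_isCPTP _), Finset.prod_const, Finset.card_univ,
    Fintype.card_fin] at h
  let G : SuperOp n := N.cycle (Fin.last k) ∘ₗ conjLin (pauliOp a) ∘ₗ
    conjLin (tensor (U (Fin.last k)))
  have hG : ∀ ρ, N.cycle (Fin.last k) (conjBy (pauliOp a) (conjBy (tensor (U (Fin.last k))) ρ)) =
      G ρ := fun _ => rfl
  simp only [noisyState_snoc, hG, sum_smul_map G, h, sum_smul_map (foldLin _), sum_prepPad]
  rfl

theorem expDist_eq_re (N : Noise n k) (cz : Fin k → CZCycle n) (U : Gates n k)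
    (s : Fin n → Fin 2) :
    expDist N cz U s =
      (∑ a : PauliString n, ((4 : ℂ) ^ n)⁻¹ • conjBy (pauliOp a) (N.cycle (Fin.last k)
        (conjBy (pauliOp a) (conjBy (tensor (U (Fin.last k))) (twirledState N cz U)))) s s).re := by
  have h : ∀ a : PauliString n, conjBy (pauliOp a) (N.cycle (Fin.last k)
      (conjBy (pauliOp a) (conjBy (tensor (U (Fin.last k))) (twirledState N cz U)))) s s =
        ∑ g, ∑ A : Fin k → PauliString n, (((2 : ℂ) ^ n)⁻¹ * (((4 : ℂ) ^ n)⁻¹) ^ k) *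
          noisyState N cz U g (Fin.snoc (α := fun _ => PauliString n) A a)
            (s + flips a) (s + flips a) := by
    intro a
    rw [← sum_noisyState, conjBy_pauliOp_diag]
    simp only [Matrix.sum_apply, Matrix.smul_apply, Finset.smul_sum, smul_eq_mul, mul_assoc]
  have hw : ((4 : ℂ) ^ n)⁻¹ * ((2 : ℂ) ^ n)⁻¹ * (((4 : ℂ) ^ n)⁻¹) ^ k =
      ((((2 : ℝ) ^ n * ((4 : ℝ) ^ n) ^ (k + 1))⁻¹ : ℝ) : ℂ) := by
    push_cast
    rw [mul_inv, pow_succ, mul_inv, inv_pow]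
    ring
  simp only [h, smul_eq_mul, Finset.mul_sum, ← mul_assoc ((4 : ℂ) ^ n)⁻¹, hw, Complex.re_sum,
    Complex.re_ofReal_mul]
  rw [Finset.sum_comm, expDist, Finset.sum_div]
  refine Finset.sum_congr rfl fun g _ => ?_
  rw [Finset.sum_comm, sum_snoc, Finset.sum_div]
  refine Finset.sum_congr rfl fun A _ => ?_
  rw [Finset.sum_div]
  refine Finset.sum_congr rfl fun a _ => ?_
  rw [Fin.snoc_last, div_eq_inv_mul]
  simp only [Fintype.card_fun, Fintype.card_fin, show Fintype.card Pauli = 4 from rfl]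
  push_cast
  rfl

theorem conjBy_foldl (W : Fin k → Op n) (V ρ : Op n) :
    conjBy (Fin.foldl k (fun V j => W j * V) V) ρ =
      foldLin (fun j => conjLin (W j)) (conjBy V ρ) := by
  induction k with
  | zero => simp [foldLin_apply]
  | succ k ih =>
    rw [Fin.foldl_succ_last, foldLin_succ, ← conjBy_conjBy, ih]
    rfl

theorem conjBy_faultyOp (cz : Fin k → CZCycle n) (U : Gates n k) (P₀ Pₘ : PauliString n)
    (P : Fin k → PauliString n) (ρ : Op n) :
    conjBy (faultyOp cz U (Fin.cons (α := fun _ => PauliString n) P₀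
        (Fin.snoc (α := fun _ => PauliString n) P Pₘ))) ρ =
      conjBy (pauliOp Pₘ) (conjBy (tensor (U (Fin.last k)))
        (foldLin (fun j => conjLin (pauliOp (P j) * (cz j).op * tensor (U j.castSucc)))
          (conjBy (pauliOp P₀) ρ))) := by
  rw [faultyOp, ← Fin.succ_last]
  simp only [Fin.cons_succ, Fin.snoc_last, Fin.snoc_castSucc, Fin.cons_zero]
  rw [← conjBy_conjBy, ← conjBy_conjBy, conjBy_foldl]

theorem patternProb_cons_snoc (N : Noise n k) (P₀ Pₘ : PauliString n) (P : Fin k → PauliString n) :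
    patternProb N (Fin.cons (α := fun _ => PauliString n) P₀
        (Fin.snoc (α := fun _ => PauliString n) P Pₘ)) =
      prepRate N.prep P₀ * ((∏ j, twirlRate (N.cycle j.castSucc) (P j)) *
        measRate (N.cycle (Fin.last k)) Pₘ) := by
  rw [patternProb, Fin.prod_univ_succ, Fin.prod_univ_castSucc]
  simp only [Fin.cons_succ, Fin.snoc_last, Fin.snoc_castSucc, Fin.cons_zero, errorRate_zero,
    errorRate_succ_castSucc, errorRate_succ_last]

theorem expDist_eq (N : Noise n k) (cz : Fin k → CZCycle n) (U : Gates n k)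
    (s : Fin n → Fin 2) :
    expDist N cz U s = ∑ P, patternProb N P * patternDist cz U P s := by
  have h1 : ∑ a : PauliString n, ((4 : ℂ) ^ n)⁻¹ • conjBy (pauliOp a) (N.cycle (Fin.last k)
        (conjBy (pauliOp a) (conjBy (tensor (U (Fin.last k))) (twirledState N cz U)))) s s =
      ∑ P : PauliString n, (measRate (N.cycle (Fin.last k)) P : ℂ) *
        conjBy (pauliOp P) (conjBy (tensor (U (Fin.last k))) (twirledState N cz U)) s s := by
    have h := congrFun (congrFun (pauliTwirl (N.cycle_isCPTP (Fin.last k))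
      (conjBy (tensor (U (Fin.last k))) (twirledState N cz U))) s) s
    simp only [Matrix.sum_apply, Matrix.smul_apply] at h
    rw [h]
    simp only [conjBy_pauliOp_diag]
    have := sum_measRate_smul (N.cycle (Fin.last k)) fun x =>
      conjBy (tensor (U (Fin.last k))) (twirledState N cz U) (s + x) (s + x)
    simpa only [Complex.real_smul, smul_eq_mul] using this.symm
  have h2 : twirledState N cz U = ∑ P₀ : PauliString n, ∑ P : Fin k → PauliString n,
      ((prepRate N.prep P₀ * ∏ j, twirlRate (N.cycle j.castSucc) (P j) : ℝ) : ℂ) •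
        foldLin (fun j => conjLin (pauliOp (P j) * (cz j).op * tensor (U j.castSucc)))
          (conjBy (pauliOp P₀) (zeroState n)) := by
    have h := fun ρ => sum_prod_smul_foldLin
      (fun (j : Fin k) (P : PauliString n) => (twirlRate (N.cycle j.castSucc) P : ℂ))
      (fun j P => conjLin (pauliOp P * (cz j).op * tensor (U j.castSucc))) ρ
    rw [twirledState, ← sum_prepRate_conjBy N.prep_isCPTP, map_sum]
    refine Finset.sum_congr rfl fun P₀ _ => ?_
    rw [map_smul]
    simp only [twirledCycle, ← h, Finset.smul_sum, smul_smul]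
    push_cast
    rfl
  rw [expDist_eq_re, h1]
  have h3 : ∑ P : PauliString n, (measRate (N.cycle (Fin.last k)) P : ℂ) *
        conjBy (pauliOp P) (conjBy (tensor (U (Fin.last k))) (twirledState N cz U)) s s =
      ((∑ P, patternProb N P * patternDist cz U P s : ℝ) : ℂ) := by
    push_cast
    rw [sum_cons]
    simp only [sum_snoc (k := k), patternProb_cons_snoc, patternDist, ← conjBy_zeroState_diag,
      conjBy_faultyOp]
    simp only [h2, ← conjLin_apply, map_sum, map_smul, Matrix.sum_apply, Matrix.smul_apply,
      Finset.mul_sum]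
    rw [Finset.sum_comm]
    refine Finset.sum_congr rfl fun P₀ _ => ?_
    rw [Finset.sum_comm]
    refine Finset.sum_congr rfl fun P _ => Finset.sum_congr rfl fun Pₘ _ => ?_
    rw [smul_eq_mul]
    push_cast
    ring
  rw [h3, Complex.ofReal_re]

/-! ### Patterns of errors -/

theorem patternProb_nonneg (N : Noise n k) (P : Pattern n k) : 0 ≤ patternProb N P :=
  Finset.prod_nonneg fun _ _ => errorRate_nonneg N _ _

theorem sum_patternProb (N : Noise n k) : ∑ P, patternProb N P = 1 := by
  simp only [patternProb]
  rw [sum_prod_fun fun j P => errorRate N j P]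
  simp only [sum_errorRate, Finset.prod_const_one]

/-- The detection argument needs end errors that pass through `H^t`; patterns without this property
carry no weight. -/
theorem isFlipString_of_patternProb_ne_zero {N : Noise n k} {P : Pattern n k}
    (h : patternProb N P ≠ 0) : IsFlipString (P 0) ∧ IsFlipString (P (Fin.last (k + 1))) := by
  rw [patternProb, Finset.prod_ne_zero_iff] at h
  constructor
  · have := h 0 (Finset.mem_univ _)
    rw [errorRate_zero, prepRate] at this
    exact not_not.1 fun hP => this (if_neg hP)
  · have := h (Fin.last (k + 1)) (Finset.mem_univ _)
    rw [← Fin.succ_last, errorRate_succ_last, measRate] at this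
    exact not_not.1 fun hP => this (if_neg hP)

theorem sum_patternProb_mul_le (N : Noise n k) {f : Pattern n k → ℝ} (h0 : f (noError n k) ≤ 0)
    (h1 : ∀ P, f P ≤ 1) : ∑ P, patternProb N P * f P ≤ pErr N := by
  rw [pErr, Finset.sum_filter]
  refine Finset.sum_le_sum fun P _ => ?_
  split_ifs with h
  · exact mul_le_of_le_one_right (patternProb_nonneg N P) (h1 P)
  · rw [not_ne_iff] at h
    subst h
    exact mul_nonpos_of_nonneg_of_nonpos (patternProb_nonneg N _) h0

theorem foldl_mem {M : Type*} [Monoid M] (S : Submonoid M) {W : Fin k → M} (hW : ∀ j, W j ∈ S)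
    {V : M} (hV : V ∈ S) : Fin.foldl k (fun V j => W j * V) V ∈ S := by
  induction k with
  | zero => simpa
  | succ k ih =>
    rw [Fin.foldl_succ_last]
    exact S.mul_mem (hW _) (ih fun j => hW j.castSucc)

theorem faultyOp_mem_unitaryGroup (cz : Fin k → CZCycle n) {U : Gates n k}
    (hU : ∀ j i, U j i ∈ Matrix.unitaryGroup (Fin 2) ℂ) (P : Pattern n k) :
    faultyOp cz U P ∈ Matrix.unitaryGroup (Fin n → Fin 2) ℂ := by
  refine mul_mem (mul_mem (pauliOp_mem_unitaryGroup _) (tensor_mem_unitaryGroup (hU _)))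
    (foldl_mem _ (fun j => ?_) (pauliOp_mem_unitaryGroup _))
  exact mul_mem (mul_mem (pauliOp_mem_unitaryGroup _) (cz j).op_mem_unitaryGroup)
    (tensor_mem_unitaryGroup (hU _))

theorem sum_norm_sq_unitary {V : Op n} (hV : V ∈ Matrix.unitaryGroup (Fin n → Fin 2) ℂ)
    (c : Fin n → Fin 2) : ∑ s, ‖V s c‖ ^ 2 = 1 := by
  have h := congrFun (congrFun (Matrix.mem_unitaryGroup_iff'.1 hV) c) c
  rw [Matrix.star_eq_conjTranspose, Matrix.mul_apply, Matrix.one_apply_eq] at h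
  have h' : ((∑ s, ‖V s c‖ ^ 2 : ℝ) : ℂ) = 1 := by
    rw [← h]
    push_cast
    refine Finset.sum_congr rfl fun s _ => ?_
    rw [Matrix.conjTranspose_apply, Complex.star_def, Complex.conj_mul']
  exact_mod_cast h'

theorem patternDist_nonneg (cz : Fin k → CZCycle n) (U : Gates n k) (P : Pattern n k)
    (s : Fin n → Fin 2) : 0 ≤ patternDist cz U P s := sq_nonneg _

theorem sum_patternDist (cz : Fin k → CZCycle n) {U : Gates n k}
    (hU : ∀ j i, U j i ∈ Matrix.unitaryGroup (Fin 2) ℂ) (P : Pattern n k) :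
    ∑ s, patternDist cz U P s = 1 :=
  sum_norm_sq_unitary (faultyOp_mem_unitaryGroup cz hU P) 0

theorem varDist_le_pErr (N : Noise n k) (cz : Fin k → CZCycle n) {U : Gates n k}
    (hU : ∀ j i, U j i ∈ Matrix.unitaryGroup (Fin 2) ℂ) : varDist N cz U ≤ pErr N := by
  have h : ∀ s, |idealDist cz U s - expDist N cz U s| ≤
      ∑ P, patternProb N P * |idealDist cz U s - patternDist cz U P s| := by
    intro s
    have : idealDist cz U s - expDist N cz U s =
        ∑ P, patternProb N P * (idealDist cz U s - patternDist cz U P s) := by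
      simp only [mul_sub, Finset.sum_sub_distrib, ← Finset.sum_mul, sum_patternProb, one_mul,
        expDist_eq]
    rw [this]
    refine (Finset.abs_sum_le_sum_abs _ _).trans_eq (Finset.sum_congr rfl fun P _ => ?_)
    rw [abs_mul, abs_of_nonneg (patternProb_nonneg N P)]
  calc varDist N cz U
      ≤ (1 / 2) * ∑ s, ∑ P, patternProb N P * |idealDist cz U s - patternDist cz U P s| :=
        mul_le_mul_of_nonneg_left (Finset.sum_le_sum fun s _ => h s) (by norm_num)
    _ = ∑ P, patternProb N P *
          ((1 / 2) * ∑ s, |idealDist cz U s - patternDist cz U P s|) := by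
        rw [Finset.sum_comm, Finset.mul_sum]
        refine Finset.sum_congr rfl fun P _ => ?_
        rw [← Finset.mul_sum]
        ring
    _ ≤ pErr N := by
        refine sum_patternProb_mul_le N (by simp [idealDist]) fun P => ?_
        have : ∑ s, |idealDist cz U s - patternDist cz U P s| ≤
            ∑ s, (idealDist cz U s + patternDist cz U P s) := by
          refine Finset.sum_le_sum fun s _ => (abs_sub _ _).trans_eq ?_
          rw [abs_of_nonneg (patternDist_nonneg cz U P s),
            abs_of_nonneg (show 0 ≤ idealDist cz U s from patternDist_nonneg _ _ _ _)]
        rw [Finset.sum_add_distrib, sum_patternDist cz hU,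
          show ∑ s, idealDist cz U s = 1 from sum_patternDist cz hU _] at this
        linarith

/-! ### Clifford operators -/

theorem exists_norm_one_mul {u v : ℂ} (hu : ‖u‖ = 1) (hv : ‖v‖ = 1) : ‖u * v‖ = 1 := by
  rw [norm_mul, hu, hv, one_mul]

theorem Pauli.exists_mat_mul (p q : Pauli) :
    ∃ (r : Pauli) (u : ℂ), ‖u‖ = 1 ∧ p.mat * q.mat = u • r.mat := by
  have key : ∃ (r : Pauli) (u : ℂ), u ∈ ({1, Complex.I, -Complex.I} : Set ℂ) ∧
      p.mat * q.mat = u • r.mat := by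
    cases p <;> cases q
    · exact ⟨.I, 1, by simp, by simp [mat]⟩
    · exact ⟨.X, 1, by simp, by simp [mat]⟩
    · exact ⟨.Y, 1, by simp, by simp [mat]⟩
    · exact ⟨.Z, 1, by simp, by simp [mat]⟩
    · exact ⟨.X, 1, by simp, by simp [mat]⟩
    · exact ⟨.I, 1, by simp, by simp [mat]⟩
    · exact ⟨.Z, Complex.I, by simp, by simp [mat]⟩
    · exact ⟨.Y, -Complex.I, by simp, by simp [mat]⟩
    · exact ⟨.Y, 1, by simp, by simp [mat]⟩
    · exact ⟨.Z, -Complex.I, by simp, by simp [mat]⟩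
    · exact ⟨.I, 1, by simp, by simp [mat]⟩
    · exact ⟨.X, Complex.I, by simp, by simp [mat]⟩
    · exact ⟨.Z, 1, by simp, by simp [mat]⟩
    · exact ⟨.Y, Complex.I, by simp, by simp [mat]⟩
    · exact ⟨.X, -Complex.I, by simp, by simp [mat]⟩
    · exact ⟨.I, 1, by simp, by simp [mat]⟩
  obtain ⟨r, u, hu, h⟩ := key
  refine ⟨r, u, ?_, h⟩
  rcases hu with rfl | rfl | rfl <;> simp

theorem tensor_smul (u : Fin n → ℂ) (A : Fin n → Matrix (Fin 2) (Fin 2) ℂ) :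
    (tensor fun i => u i • A i) = (∏ i, u i) • tensor A := by
  ext r c
  simp [tensor, Finset.prod_mul_distrib]

theorem exists_pauliOp_mul (P Q : PauliString n) :
    ∃ (R : PauliString n) (u : ℂ), ‖u‖ = 1 ∧ pauliOp P * pauliOp Q = u • pauliOp R := by
  choose R u hu h using fun i => (P i).exists_mat_mul (Q i)
  refine ⟨R, ∏ i, u i, by simp [hu], ?_⟩
  simp only [pauliOp, tensor_mul, h, tensor_smul]

/-- Operators that normalise the Pauli group. -/
def IsClifford (V : Op n) : Prop :=
  ∀ P : PauliString n, ∃ (Q : PauliString n) (u : ℂ),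
    ‖u‖ = 1 ∧ V * pauliOp P = u • (pauliOp Q * V)

theorem IsClifford.mul {V W : Op n} (hV : IsClifford V) (hW : IsClifford W) :
    IsClifford (V * W) := by
  intro P
  obtain ⟨Q, u, hu, hQ⟩ := hW P
  obtain ⟨R, v, hv, hR⟩ := hV Q
  refine ⟨R, u * v, exists_norm_one_mul hu hv, ?_⟩
  rw [Matrix.mul_assoc, hQ, Matrix.mul_smul, ← Matrix.mul_assoc, hR, Matrix.smul_mul, smul_smul,
    Matrix.mul_assoc]

theorem CZCycle.isClifford_op (c : CZCycle n) : IsClifford c.op := by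
  intro P
  obtain ⟨v, hv, h⟩ := c.op_mul_pauliOp_mul_op P
  refine ⟨c.act P, v, hv, ?_⟩
  rw [← Matrix.smul_mul, ← h, Matrix.mul_assoc, c.op_mul_self, Matrix.mul_one]

theorem isClifford_tensor {A : Fin n → Matrix (Fin 2) (Fin 2) ℂ}
    (hA : ∀ i (p : Pauli), ∃ (q : Pauli) (u : ℂ), ‖u‖ = 1 ∧ A i * p.mat = u • (q.mat * A i)) :
    IsClifford (tensor A) := by
  intro P
  choose Q u hu h using fun i => hA i (P i)
  refine ⟨Q, ∏ i, u i, by simp [hu], ?_⟩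
  simp only [pauliOp, tensor_mul, h, tensor_smul]

theorem gateH_mul_pauli (p : Pauli) :
    ∃ (q : Pauli) (u : ℂ), ‖u‖ = 1 ∧ gateH * p.mat = u • (q.mat * gateH) := by
  cases p
  · exact ⟨.I, 1, by simp, by simp [gateH, Pauli.mat]⟩
  · exact ⟨.Z, 1, by simp, by simp [gateH, Pauli.mat]⟩
  · exact ⟨.Y, -1, by simp, by simp [gateH, Pauli.mat, mul_comm]⟩
  · exact ⟨.X, 1, by simp, by simp [gateH, Pauli.mat]⟩

theorem gateS_mul_pauli (p : Pauli) :
    ∃ (q : Pauli) (u : ℂ), ‖u‖ = 1 ∧ gateS * p.mat = u • (q.mat * gateS) := by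
  cases p
  · exact ⟨.I, 1, by simp, by simp [gateS, Pauli.mat]⟩
  · exact ⟨.Y, 1, by simp, by simp [gateS, Pauli.mat]⟩
  · exact ⟨.X, -1, by simp, by simp [gateS, Pauli.mat]⟩
  · exact ⟨.Z, 1, by simp, by simp [gateS, Pauli.mat]⟩

theorem gateS_conjTranspose : gateS.conjTranspose = !![1, 0; 0, -Complex.I] := by
  ext a b
  fin_cases a <;> fin_cases b <;> simp [gateS]

theorem gateS_conjTranspose_mul_pauli (p : Pauli) :
    ∃ (q : Pauli) (u : ℂ), ‖u‖ = 1 ∧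
      gateS.conjTranspose * p.mat = u • (q.mat * gateS.conjTranspose) := by
  rw [gateS_conjTranspose]
  cases p
  · exact ⟨.I, 1, by simp, by simp [Pauli.mat]⟩
  · exact ⟨.Y, -1, by simp, by simp [Pauli.mat]⟩
  · exact ⟨.X, 1, by simp, by simp [Pauli.mat]⟩
  · exact ⟨.Z, 1, by simp, by simp [Pauli.mat]⟩

theorem gateH_conjTranspose : gateH.conjTranspose = gateH := by
  ext a b
  fin_cases a <;> fin_cases b <;> simp [gateH]

theorem gateH_mul_self : gateH * gateH = 1 := by
  have h : ((Real.sqrt 2 : ℝ) : ℂ) * ((Real.sqrt 2 : ℝ) : ℂ) = 2 := by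
    rw [← Complex.ofReal_mul, Real.mul_self_sqrt (by norm_num)]
    norm_num
  have h2 : (!![1, 1; 1, -1] : Matrix (Fin 2) (Fin 2) ℂ) * !![1, 1; 1, -1] = (2 : ℂ) • 1 := by
    ext a b
    fin_cases a <;> fin_cases b <;> simp <;> norm_num
  rw [gateH, Matrix.smul_mul, Matrix.mul_smul, smul_smul, h2, smul_smul, ← mul_inv, h]
  norm_num

theorem gateH_mem_unitaryGroup : gateH ∈ Matrix.unitaryGroup (Fin 2) ℂ := by
  rw [Matrix.mem_unitaryGroup_iff, Matrix.star_eq_conjTranspose, gateH_conjTranspose,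
    gateH_mul_self]

theorem gateS_mem_unitaryGroup : gateS ∈ Matrix.unitaryGroup (Fin 2) ℂ := by
  rw [Matrix.mem_unitaryGroup_iff, Matrix.star_eq_conjTranspose, gateS_conjTranspose]
  ext a b
  fin_cases a <;> fin_cases b <;> simp [gateS]

/-! ### The structure of trap circuits -/

/-- The layer `H^t` at the beginning and at the end of a trap circuit. -/
noncomputable def layerOp (n : ℕ) (t : Bool) : Op n := tensor fun _ => if t then gateH else 1

/-- The random gates of a trap circuit before a cycle of controlled-`Z` gates. -/
noncomputable def trapLayer (r : Fin n → Bool) : Op n :=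
  tensor fun i => if r i then gateH else gateS

/-- A trap circuit without its first and last Hadamard layers and error strings. -/
noncomputable def trapCore (cz : Fin k → CZCycle n) (r : Fin k → Fin n → Bool) (P : Pattern n k) :
    Op n :=
  Fin.foldl k (fun V j => ((trapLayer (r j)).conjTranspose * pauliOp (P j.castSucc.succ) *
    (cz j).op * trapLayer (r j)) * V) 1

theorem layerGate_mul_self (t : Bool) :
    (if t then gateH else 1 : Matrix (Fin 2) (Fin 2) ℂ) * (if t then gateH else 1) = 1 := by
  cases t <;> simp [gateH_mul_self]

theorem layerOp_mul_self (t : Bool) : layerOp n t * layerOp n t = 1 := by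
  rw [layerOp, tensor_mul, ← tensor_one]
  simp only [layerGate_mul_self]

theorem layerGate_mem_unitaryGroup (t : Bool) :
    (if t then gateH else 1) ∈ Matrix.unitaryGroup (Fin 2) ℂ := by
  cases t
  · simp
  · simpa using gateH_mem_unitaryGroup

theorem trapLayer_mem_unitaryGroup (r : Fin n → Bool) :
    trapLayer r ∈ Matrix.unitaryGroup (Fin n → Fin 2) ℂ := by
  refine tensor_mem_unitaryGroup fun i => ?_
  split_ifs
  · exact gateH_mem_unitaryGroup
  · exact gateS_mem_unitaryGroup

theorem conjTranspose_mem_unitaryGroup {m : Type*} [Fintype m] [DecidableEq m] {A : Matrix m m ℂ}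
    (hA : A ∈ Matrix.unitaryGroup m ℂ) : A.conjTranspose ∈ Matrix.unitaryGroup m ℂ :=
  Unitary.star_mem hA

theorem trapGates_mem_unitaryGroup (c : TrapChoice n k) (j : Fin (k + 1)) (i : Fin n) :
    trapGates c j i ∈ Matrix.unitaryGroup (Fin 2) ℂ := by
  have h : ∀ l, (if c.2 l i then gateH else gateS) ∈ Matrix.unitaryGroup (Fin 2) ℂ := by
    intro l
    split_ifs
    · exact gateH_mem_unitaryGroup
    · exact gateS_mem_unitaryGroup
  refine mul_mem ?_ ?_
  · refine Fin.lastCases ?_ (fun l => ?_) j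
    · simpa only [Fin.lastCases_last] using layerGate_mem_unitaryGroup c.1
    · simpa only [Fin.lastCases_castSucc] using h l
  · refine Fin.cases ?_ (fun l => ?_) j
    · exact layerGate_mem_unitaryGroup c.1
    · exact conjTranspose_mem_unitaryGroup (h l)

/-- Undoes the compilation of trap gates: the brackets of an alternating product move by one place,
so that each undoing layer joins the `cZ` cycle before it. -/
theorem foldl_shift {M : Type*} [Monoid M] (X : Fin k → M) (Y : Fin (k + 1) → M) (V : M) :
    Y (Fin.last k) * Fin.foldl k (fun V j => X j * Y j.castSucc * V) V =
      Fin.foldl k (fun V j => Y j.succ * X j * V) (Y 0 * V) := by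
  induction k with
  | zero => simp
  | succ k ih =>
    rw [Fin.foldl_succ_last, Fin.foldl_succ_last]
    have := ih (fun j => X j.castSucc) fun j => Y j.castSucc
    simp only [Fin.castSucc_zero, ← Fin.succ_castSucc] at this ⊢
    rw [← this, ← Fin.succ_last]
    simp only [mul_assoc]

theorem foldl_mul_right {M : Type*} [Monoid M] (W : Fin k → M) (V : M) :
    Fin.foldl k (fun V j => W j * V) V = Fin.foldl k (fun V j => W j * V) 1 * V := by
  induction k with
  | zero => simp
  | succ k ih => rw [Fin.foldl_succ_last, Fin.foldl_succ_last, ih, mul_assoc]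

theorem faultyOp_trapGates (cz : Fin k → CZCycle n) (t : Bool) (r : Fin k → Fin n → Bool)
    (P : Pattern n k) :
    faultyOp cz (trapGates (t, r)) P =
      pauliOp (P (Fin.last (k + 1))) * layerOp n t * trapCore cz r P * layerOp n t *
        pauliOp (P 0) := by
  let Y : Fin (k + 1) → Op n := Fin.cases (layerOp n t) fun l => (trapLayer (r l)).conjTranspose
  have hY : ∀ j, (tensor fun i => Fin.cases (motive := fun _ => Matrix (Fin 2) (Fin 2) ℂ)
      (if t then gateH else 1)
      (fun l => (if r l i then gateH else gateS : Matrix (Fin 2) (Fin 2) ℂ).conjTranspose) j) =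
        Y j := by
    intro j
    refine Fin.cases rfl (fun l => ?_) j
    simp only [Y, Fin.cases_succ, trapLayer, tensor_conjTranspose]
  have hlast : tensor (trapGates (t, r) (Fin.last k)) = layerOp n t * Y (Fin.last k) := by
    rw [← hY, layerOp, tensor_mul]
    congr 1
    funext i
    simp only [trapGates, Fin.lastCases_last]
  have hcast : ∀ j : Fin k, tensor (trapGates (t, r) j.castSucc) =
      trapLayer (r j) * Y j.castSucc := by
    intro j
    rw [← hY, trapLayer, tensor_mul]
    congr 1
    funext i
    simp only [trapGates, Fin.lastCases_castSucc]
  have hshift := foldl_shift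
    (fun j => pauliOp (P j.castSucc.succ) * (cz j).op * trapLayer (r j)) Y (pauliOp (P 0))
  rw [foldl_mul_right fun j => Y j.succ * (pauliOp (P j.castSucc.succ) * (cz j).op *
    trapLayer (r j))] at hshift
  have hcore : trapCore cz r P = Fin.foldl k (fun V j => Y j.succ *
      (pauliOp (P j.castSucc.succ) * (cz j).op * trapLayer (r j)) * V) 1 := by
    rw [trapCore]
    congr 1
    funext V j
    simp only [Y, Fin.cases_succ, mul_assoc]
  have hfaulty : faultyOp cz (trapGates (t, r)) P = pauliOp (P (Fin.last (k + 1))) *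
      (layerOp n t * Y (Fin.last k)) * Fin.foldl k (fun V j =>
        pauliOp (P j.castSucc.succ) * (cz j).op * trapLayer (r j) * Y j.castSucc * V)
        (pauliOp (P 0)) := by
    rw [faultyOp, hlast]
    simp only [hcast, mul_assoc]
  rw [hfaulty, hcore, ← mul_assoc, mul_assoc _ (Y (Fin.last k)), hshift]
  simp only [mul_assoc]
  rfl

theorem isClifford_trapLayer (r : Fin n → Bool) : IsClifford (trapLayer r) := by
  refine isClifford_tensor fun i p => ?_
  cases r i
  · exact gateS_mul_pauli p
  · exact gateH_mul_pauli p

theorem isClifford_conjTranspose_trapLayer (r : Fin n → Bool) :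
    IsClifford (trapLayer r).conjTranspose := by
  rw [trapLayer, tensor_conjTranspose]
  refine isClifford_tensor fun i p => ?_
  cases r i
  · exact gateS_conjTranspose_mul_pauli p
  · simpa only [if_true, gateH_conjTranspose] using gateH_mul_pauli p

/-- All errors of a Clifford circuit can be commuted to its end. -/
theorem exists_foldl_pauli {A B : Fin k → Op n} (hA : ∀ j, IsClifford (A j))
    (hB : ∀ j, IsClifford (B j)) (P : Fin k → PauliString n) :
    ∃ (Q : PauliString n) (u : ℂ), ‖u‖ = 1 ∧
      Fin.foldl k (fun V j => (A j * pauliOp (P j) * B j) * V) 1 =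
        u • (pauliOp Q * Fin.foldl k (fun V j => (A j * B j) * V) 1) := by
  induction k with
  | zero => exact ⟨fun _ => .I, 1, by simp, by simp [pauliOp_noError]⟩
  | succ k ih =>
    obtain ⟨Q, u, hu, hQ⟩ := ih (fun j => hA j.castSucc) (fun j => hB j.castSucc)
      fun j => P j.castSucc
    obtain ⟨Q₁, u₁, hu₁, hQ₁⟩ := hB (Fin.last k) Q
    obtain ⟨Q₂, u₂, hu₂, hQ₂⟩ := exists_pauliOp_mul (P (Fin.last k)) Q₁
    obtain ⟨Q₃, u₃, hu₃, hQ₃⟩ := hA (Fin.last k) Q₂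
    refine ⟨Q₃, u * (u₁ * (u₂ * u₃)), by simp [hu, hu₁, hu₂, hu₃], ?_⟩
    rw [Fin.foldl_succ_last, Fin.foldl_succ_last, hQ]
    calc _ = u • (A (Fin.last k) * (pauliOp (P (Fin.last k)) * (B (Fin.last k) * pauliOp Q)) *
          Fin.foldl k (fun V j => A j.castSucc * B j.castSucc * V) 1) := by
          simp only [mul_assoc, mul_smul_comm]
      _ = (u * u₁) • (A (Fin.last k) * (pauliOp (P (Fin.last k)) * pauliOp Q₁) *
          (B (Fin.last k) * Fin.foldl k (fun V j => A j.castSucc * B j.castSucc * V) 1)) := by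
          simp only [hQ₁, mul_assoc, mul_smul_comm, smul_mul_assoc, smul_smul]
      _ = (u * u₁ * u₂) • ((A (Fin.last k) * pauliOp Q₂) *
          (B (Fin.last k) * Fin.foldl k (fun V j => A j.castSucc * B j.castSucc * V) 1)) := by
          simp only [hQ₂, mul_smul_comm, smul_mul_assoc, smul_smul]
      _ = _ := by
          simp only [hQ₃, mul_assoc, smul_mul_assoc, smul_smul]

theorem isClifford_foldl {W : Fin k → Op n} (hW : ∀ j, IsClifford (W j)) :
    IsClifford (Fin.foldl k (fun V j => W j * V) 1) := by
  induction k with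
  | zero => exact fun P => ⟨P, 1, by simp, by simp⟩
  | succ k ih =>
    rw [Fin.foldl_succ_last]
    exact (hW _).mul (ih fun j => hW j.castSucc)

theorem pauliOp_noError_apply (j : Fin (k + 2)) : pauliOp (noError n k j) = 1 :=
  pauliOp_noError

theorem trapCore_noError (cz : Fin k → CZCycle n) (r : Fin k → Fin n → Bool) :
    trapCore cz r (noError n k) = Fin.foldl k (fun V j =>
      ((trapLayer (r j)).conjTranspose * ((cz j).op * trapLayer (r j))) * V) 1 := by
  simp only [trapCore, pauliOp_noError_apply, mul_one, mul_assoc]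

/-- `H` anticommutes with `Y`. This is the benefit of representing a flip by `Y`: `X` would become
`Z` under `H`. -/
theorem layerOp_mul_pauliOp {P : PauliString n} (hP : IsFlipString P) (t : Bool) :
    ∃ u : ℂ, ‖u‖ = 1 ∧ layerOp n t * pauliOp P = u • (pauliOp P * layerOp n t) := by
  have h : ∀ i, ∃ u : ℂ, ‖u‖ = 1 ∧ (if t then gateH else 1) * (P i).mat =
      u • ((P i).mat * if t then gateH else 1) := by
    intro i
    cases t
    · exact ⟨1, by simp, by simp⟩
    · rcases hP i with h | h
      · exact ⟨1, by simp, by simp [h, gateH, Pauli.mat]⟩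
      · exact ⟨-1, by simp, by simp [h, gateH, Pauli.mat, mul_comm]⟩
  choose u hu h using h
  refine ⟨∏ i, u i, by simp [hu], ?_⟩
  simp only [pauliOp, layerOp, tensor_mul, h, tensor_smul]

/-- The merged error of a trap circuit is a Pauli string, up to a phase and the final Hadamard
layer. -/
theorem exists_faultyOp_trapGates (cz : Fin k → CZCycle n) (r : Fin k → Fin n → Bool)
    {P : Pattern n k} (h0 : IsFlipString (P 0)) (hm : IsFlipString (P (Fin.last (k + 1)))) :
    ∃ R : PauliString n, ∀ t, ∃ v : ℂ, ‖v‖ = 1 ∧ faultyOp cz (trapGates (t, r)) P =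
      v • (layerOp n t * pauliOp R * layerOp n t *
        faultyOp cz (trapGates (t, r)) (noError n k)) := by
  have hA := fun j => isClifford_conjTranspose_trapLayer (r j)
  have hB := fun j => (cz j).isClifford_op.mul (isClifford_trapLayer (r j))
  obtain ⟨Q, u, hu, hQ⟩ := exists_foldl_pauli hA hB fun j => P j.castSucc.succ
  have hQ' : trapCore cz r P = u • (pauliOp Q * trapCore cz r (noError n k)) := by
    rw [trapCore_noError, ← hQ, trapCore]
    simp only [mul_assoc]
  have hC : IsClifford (trapCore cz r (noError n k)) := by
    rw [trapCore_noError]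
    exact isClifford_foldl fun j => (hA j).mul (hB j)
  obtain ⟨Q₁, u₁, hu₁, hQ₁⟩ := hC (P 0)
  obtain ⟨Q₂, u₂, hu₂, hQ₂⟩ := exists_pauliOp_mul Q Q₁
  obtain ⟨R, u₃, hu₃, hR⟩ := exists_pauliOp_mul (P (Fin.last (k + 1))) Q₂
  -- `R` is chosen before `t`: only the phases `a` and `b` depend on the Hadamard layers.
  refine ⟨R, fun t => ?_⟩
  obtain ⟨a, ha, ha'⟩ := layerOp_mul_pauliOp h0 t
  obtain ⟨b, hb, hb'⟩ := layerOp_mul_pauliOp hm t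
  have hb₀ : b ≠ 0 := fun h => by simp [h] at hb
  have hb'' : pauliOp (P (Fin.last (k + 1))) * layerOp n t =
      b⁻¹ • (layerOp n t * pauliOp (P (Fin.last (k + 1)))) := by
    rw [hb', smul_smul, inv_mul_cancel₀ hb₀, one_smul]
  refine ⟨b⁻¹ * a * u * u₁ * u₂ * u₃, by simp [ha, hb, hu, hu₁, hu₂, hu₃], ?_⟩
  rw [faultyOp_trapGates, faultyOp_trapGates]
  simp only [pauliOp_noError_apply, one_mul, mul_one]
  calc _ = (pauliOp (P (Fin.last (k + 1))) * layerOp n t) * trapCore cz r P *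
          (layerOp n t * pauliOp (P 0)) := by simp only [mul_assoc]
    _ = (b⁻¹ * a * u) • (layerOp n t * (pauliOp (P (Fin.last (k + 1))) * (pauliOp Q *
          (trapCore cz r (noError n k) * pauliOp (P 0)))) * layerOp n t) := by
        rw [hb'', ha', hQ']
        simp only [mul_assoc, mul_smul_comm, smul_mul_assoc, smul_smul]
        congr 1
        ring
    _ = (b⁻¹ * a * u * u₁) • (layerOp n t * (pauliOp (P (Fin.last (k + 1))) *
          (pauliOp Q * pauliOp Q₁)) * trapCore cz r (noError n k) * layerOp n t) := by
        rw [hQ₁]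
        simp only [mul_assoc, mul_smul_comm, smul_mul_assoc, smul_smul]
    _ = (b⁻¹ * a * u * u₁ * u₂ * u₃) • (layerOp n t * pauliOp R *
          trapCore cz r (noError n k) * layerOp n t) := by
        rw [hQ₂, mul_smul_comm, hR]
        simp only [mul_assoc, mul_smul_comm, smul_mul_assoc, smul_smul]
    _ = _ := by
        congr 1
        simp only [mul_assoc]
        rw [← mul_assoc (layerOp n t) (layerOp n t), layerOp_mul_self, one_mul]

/-! ### Ideal trap circuits -/

theorem mulVec_zero_ket (V : Op n) (s : Fin n → Fin 2) :
    V.mulVec (Pi.single 0 1) s = V s 0 := by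
  simp

/-- A cycle of controlled-`Z` gates fixes a product vector if one qubit in each pair is in the state
`|0⟩`. -/
theorem CZCycle.op_mulVec_tensor (c : CZCycle n) {A : Fin n → Matrix (Fin 2) (Fin 2) ℂ}
    (hA : ∀ i, c.partner i ≠ i → A i 1 0 = 0 ∨ A (c.partner i) 1 0 = 0) :
    c.op.mulVec ((tensor A).mulVec (Pi.single 0 1)) = (tensor A).mulVec (Pi.single 0 1) := by
  funext s
  rw [op_eq, Matrix.mulVec_diagonal, mulVec_zero_ket]
  change c.sign s * ∏ i, A i (s i) 0 = ∏ i, A i (s i) 0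
  by_cases h : ∏ i, A i (s i) 0 = 0
  · rw [h, mul_zero]
  · rw [← ne_eq, Finset.prod_ne_zero_iff] at h
    rw [sign, Finset.prod_eq_one, one_mul]
    intro i _
    split_ifs with hi
    · rw [bitSign, if_neg]
      rintro ⟨h1, h2⟩
      rcases hA i hi.ne' with h' | h'
      · exact h i (Finset.mem_univ _) (h1 ▸ h')
      · exact h (c.partner i) (Finset.mem_univ _) (h2 ▸ h')
    · rfl

theorem trapCore_noError_mulVec (cz : Fin k → CZCycle n) {t : Bool} {r : Fin k → Fin n → Bool}
    (hr : (t, r) ∈ trapChoices cz) :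
    (trapCore cz r (noError n k)).mulVec ((layerOp n t).mulVec (Pi.single 0 1)) =
      (layerOp n t).mulVec (Pi.single 0 1) := by
  have hr' : ∀ j i, (cz j).partner i ≠ i → r j ((cz j).partner i) = !(r j i) :=
    (Finset.mem_filter.1 hr).2
  have hstep : ∀ j, ((trapLayer (r j)).conjTranspose * ((cz j).op * trapLayer (r j))).mulVec
      ((layerOp n t).mulVec (Pi.single 0 1)) = (layerOp n t).mulVec (Pi.single 0 1) := by
    intro j
    have hfix : (cz j).op.mulVec ((trapLayer (r j) * layerOp n t).mulVec (Pi.single 0 1)) =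
        (trapLayer (r j) * layerOp n t).mulVec (Pi.single 0 1) := by
      rw [trapLayer, layerOp, tensor_mul]
      -- A qubit whose choice agrees with `t` is in the state `|0⟩` up to phase, as `HH = 1` and `S`
      -- fixes `|0⟩`. Connected qubits have opposite choices, so one of them agrees.
      have hz : ∀ i, r j i = t →
          ((if r j i then gateH else gateS) * (if t then gateH else 1)) 1 0 = 0 := by
        intro i hi
        rw [hi]
        cases t
        · simp [gateS]
        · simp [gateH_mul_self]
      refine (cz j).op_mulVec_tensor fun i hi => ?_
      by_cases h : r j i = t
      · exact Or.inl (hz i h)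
      · refine Or.inr (hz _ ?_)
        rw [hr' j i hi]
        cases hri : r j i <;> cases t <;> simp_all
    rw [← Matrix.mulVec_mulVec, ← Matrix.mulVec_mulVec, Matrix.mulVec_mulVec _ (trapLayer (r j)),
      hfix, Matrix.mulVec_mulVec, ← mul_assoc,
      ← Matrix.star_eq_conjTranspose, Matrix.mem_unitaryGroup_iff'.1 (trapLayer_mem_unitaryGroup _),
      one_mul]
  rw [trapCore_noError]
  clear hr hr'
  induction k with
  | zero => simp
  | succ k ih =>
    rw [Fin.foldl_succ_last, ← Matrix.mulVec_mulVec,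
      ih (fun j => cz j.castSucc) fun j => hstep j.castSucc]
    exact hstep _

theorem faultyOp_trapGates_noError_mulVec (cz : Fin k → CZCycle n) {c : TrapChoice n k}
    (hc : c ∈ trapChoices cz) :
    (faultyOp cz (trapGates c) (noError n k)).mulVec (Pi.single 0 1) = Pi.single 0 1 := by
  obtain ⟨t, r⟩ := c
  rw [faultyOp_trapGates]
  simp only [pauliOp_noError_apply, one_mul, mul_one]
  rw [← Matrix.mulVec_mulVec, ← Matrix.mulVec_mulVec]
  rw [trapCore_noError_mulVec cz hc, Matrix.mulVec_mulVec, layerOp_mul_self, Matrix.one_mulVec]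

/-! ### Detection of errors by trap circuits -/

theorem trapChoices_nonempty (cz : Fin k → CZCycle n) : (trapChoices cz).Nonempty := by
  -- The smaller qubit of each pair gets `H`.
  refine ⟨(false, fun j i => decide (i < (cz j).partner i)),
    Finset.mem_filter.2 ⟨Finset.mem_univ _, fun j i hi => ?_⟩⟩
  simp only [(cz j).involutive i]
  rcases lt_or_gt_of_ne hi with h | h <;> simp [h, h.not_gt]

/-- The same trap circuit with the other choice of the Hadamard layers. -/
def flipLayers (c : TrapChoice n k) : TrapChoice n k := (!c.1, c.2)

theorem flipLayers_flipLayers (c : TrapChoice n k) : flipLayers (flipLayers c) = c := by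
  simp [flipLayers]

theorem flipLayers_mem {cz : Fin k → CZCycle n} {c : TrapChoice n k} (hc : c ∈ trapChoices cz) :
    flipLayers c ∈ trapChoices cz :=
  Finset.mem_filter.2 ⟨Finset.mem_univ _, (Finset.mem_filter.1 hc).2⟩

theorem sum_trapChoices_flipLayers (cz : Fin k → CZCycle n) (f : TrapChoice n k → ℝ) :
    ∑ c ∈ trapChoices cz, f (flipLayers c) = ∑ c ∈ trapChoices cz, f c :=
  Finset.sum_nbij' flipLayers flipLayers (fun _ => flipLayers_mem) (fun _ => flipLayers_mem)
    (fun _ _ => flipLayers_flipLayers _) (fun _ _ => flipLayers_flipLayers _) fun _ _ => rfl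

theorem trapAverage_mono {cz : Fin k → CZCycle n} {f g : TrapChoice n k → ℝ}
    (h : ∀ c ∈ trapChoices cz, f c ≤ g c) : trapAverage cz f ≤ trapAverage cz g :=
  div_le_div_of_nonneg_right (Finset.sum_le_sum h) (Nat.cast_nonneg _)

theorem trapAverage_const (cz : Fin k → CZCycle n) (a : ℝ) : trapAverage cz (fun _ => a) = a := by
  have : ((trapChoices cz).card : ℝ) ≠ 0 := by
    exact_mod_cast (trapChoices_nonempty cz).card_pos.ne'
  rw [trapAverage, Finset.sum_const, nsmul_eq_mul, mul_div_cancel_left₀ _ this]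

/-- The probability that a trap circuit with a pattern of errors returns an incorrect output. -/
noncomputable def incorrect (cz : Fin k → CZCycle n) (P : Pattern n k) (c : TrapChoice n k) : ℝ :=
  ∑ s ∈ Finset.univ.filter (fun s : Fin n → Fin 2 => s ≠ 0), patternDist cz (trapGates c) P s

theorem incorrect_nonneg (cz : Fin k → CZCycle n) (P : Pattern n k) (c : TrapChoice n k) :
    0 ≤ incorrect cz P c :=
  Finset.sum_nonneg fun _ _ => patternDist_nonneg _ _ _ _

theorem incorrect_eq (cz : Fin k → CZCycle n) (P : Pattern n k) (c : TrapChoice n k) :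
    incorrect cz P c = 1 - patternDist cz (trapGates c) P 0 := by
  rw [← sum_patternDist cz (trapGates_mem_unitaryGroup c) P, incorrect, Finset.filter_ne',
    ← Finset.add_sum_erase _ _ (Finset.mem_univ 0), add_sub_cancel_left]

theorem incorrect_le_one (cz : Fin k → CZCycle n) (P : Pattern n k) (c : TrapChoice n k) :
    incorrect cz P c ≤ 1 := by
  rw [incorrect_eq]
  linarith [patternDist_nonneg cz (trapGates c) P 0]

theorem incorrect_noError (cz : Fin k → CZCycle n) {c : TrapChoice n k}
    (hc : c ∈ trapChoices cz) : incorrect cz (noError n k) c = 0 := by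
  have h := congrFun (faultyOp_trapGates_noError_mulVec cz hc) 0
  rw [mulVec_zero_ket, Pi.single_eq_same] at h
  rw [incorrect_eq, patternDist, h]
  simp

theorem layerOp_mul_pauliOp_mul_layerOp_apply_zero (t : Bool) (R : PauliString n) :
    (layerOp n t * pauliOp R * layerOp n t) 0 0 =
      ∏ i, ((if t then gateH else 1) * (R i).mat * (if t then gateH else 1)) 0 0 := by
  rw [layerOp, pauliOp, tensor_mul, tensor_mul]
  rfl

/-- The amplitude is a product over qubits, so one vanishing factor suffices: `X` and `Y` flip the
bit without Hadamard gates, and `HZH = X` flips it with them. -/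
theorem layerOp_mul_pauliOp_mul_layerOp_eq_zero {R : PauliString n} (hR : R ≠ fun _ => Pauli.I) :
    ∃ t, (layerOp n t * pauliOp R * layerOp n t) 0 0 = 0 := by
  obtain ⟨i, hi⟩ := Function.ne_iff.1 hR
  have : ∃ t : Bool, ((if t then gateH else 1) * (R i).mat * (if t then gateH else 1)) 0 0 = 0 := by
    cases h : R i
    · exact absurd h hi
    · exact ⟨false, by simp [Pauli.mat]⟩
    · exact ⟨false, by simp [Pauli.mat]⟩
    · exact ⟨true, by simp [Pauli.mat, gateH]⟩
  obtain ⟨t, ht⟩ := this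
  refine ⟨t, ?_⟩
  rw [layerOp_mul_pauliOp_mul_layerOp_apply_zero]
  exact Finset.prod_eq_zero (Finset.mem_univ i) ht

open Classical in
/-- If the errors of a pattern do not cancel, then one of the two choices of the Hadamard layers
reveals them. -/
theorem one_sub_cancels_le (cz : Fin k → CZCycle n) {P : Pattern n k} (h0 : IsFlipString (P 0))
    (hm : IsFlipString (P (Fin.last (k + 1)))) {c : TrapChoice n k} (hc : c ∈ trapChoices cz) :
    1 - (if Cancels cz (trapGates c) P then 1 else 0 : ℝ) ≤
      incorrect cz P c + incorrect cz P (flipLayers c) := by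
  obtain ⟨R, hR⟩ := exists_faultyOp_trapGates cz c.2 h0 hm
  by_cases hRI : R = fun _ => Pauli.I
  · have hcancel : Cancels cz (trapGates c) P := by
      obtain ⟨v, hv, h⟩ := hR c.1
      intro ρ
      have hF := Matrix.mem_unitaryGroup_iff.1
        (faultyOp_mem_unitaryGroup cz (trapGates_mem_unitaryGroup c) (noError n k))
      rw [Matrix.star_eq_conjTranspose] at hF
      rw [hRI, pauliOp_noError, mul_one, layerOp_mul_self, one_mul, Prod.mk.eta] at h
      rw [mergedError, h, Matrix.smul_mul, hF, conjBy_smul_left hv, conjBy]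
      simp
    rw [if_pos hcancel]
    linarith [incorrect_nonneg cz P c, incorrect_nonneg cz P (flipLayers c)]
  · obtain ⟨t, ht⟩ := layerOp_mul_pauliOp_mul_layerOp_eq_zero hRI
    have hdet : ∀ r, (t, c.2) = r → r ∈ trapChoices cz → incorrect cz P r = 1 := by
      rintro _ rfl hr
      obtain ⟨v, -, h⟩ := hR t
      have h' : faultyOp cz (trapGates (t, c.2)) P 0 0 = 0 := by
        rw [← mulVec_zero_ket (faultyOp cz (trapGates (t, c.2)) P) 0, h, Matrix.smul_mulVec,
          ← Matrix.mulVec_mulVec,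
          faultyOp_trapGates_noError_mulVec cz hr, Pi.smul_apply, mulVec_zero_ket, ht, smul_zero]
      rw [incorrect_eq, patternDist, h']
      simp
    have h1 : (1 : ℝ) - (if Cancels cz (trapGates c) P then 1 else 0) ≤ 1 := by
      split_ifs <;> norm_num
    by_cases htc : c.1 = t
    · linarith [hdet c (by rw [← htc]) hc, incorrect_nonneg cz P (flipLayers c)]
    · have : (t, c.2) = flipLayers c := by
        rw [flipLayers, ← Bool.eq_not_of_ne (Ne.symm htc)]
      linarith [hdet _ this (flipLayers_mem hc), incorrect_nonneg cz P c]

open Classical in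
theorem one_sub_trapAverage_cancels_le (cz : Fin k → CZCycle n) {P : Pattern n k}
    (h0 : IsFlipString (P 0)) (hm : IsFlipString (P (Fin.last (k + 1)))) :
    1 - trapAverage cz (fun c => if Cancels cz (trapGates c) P then 1 else 0) ≤
      2 * trapAverage cz (incorrect cz P) := by
  calc 1 - trapAverage cz (fun c => if Cancels cz (trapGates c) P then 1 else 0)
      = trapAverage cz fun c => 1 - if Cancels cz (trapGates c) P then 1 else 0 := by
        rw [eq_comm, trapAverage, Finset.sum_sub_distrib, sub_div]
        exact congrArg (· - _) (trapAverage_const cz 1)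
    _ ≤ trapAverage cz fun c => incorrect cz P c + incorrect cz P (flipLayers c) :=
        trapAverage_mono fun c hc => one_sub_cancels_le cz h0 hm hc
    _ = 2 * trapAverage cz (incorrect cz P) := by
        rw [trapAverage, Finset.sum_add_distrib, sum_trapChoices_flipLayers cz (incorrect cz P),
          trapAverage]
        ring

theorem sum_expDist_trapGates (N : Noise n k) (cz : Fin k → CZCycle n) (c : TrapChoice n k) :
    ∑ s ∈ Finset.univ.filter (fun s : Fin n → Fin 2 => s ≠ 0), expDist N cz (trapGates c) s =
      ∑ P, patternProb N P * incorrect cz P c := by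
  simp only [expDist_eq]
  rw [Finset.sum_comm]
  simp only [incorrect, Finset.mul_sum]

theorem pInc_eq (N : Noise n k) (cz : Fin k → CZCycle n) :
    pInc N cz = ∑ P, patternProb N P * trapAverage cz (incorrect cz P) := by
  simp only [pInc, sum_expDist_trapGates, trapAverage]
  rw [Finset.sum_comm, Finset.sum_div]
  refine Finset.sum_congr rfl fun P _ => ?_
  rw [← Finset.mul_sum, mul_div_assoc]

theorem trapAverage_incorrect_nonneg (cz : Fin k → CZCycle n) (P : Pattern n k) :
    0 ≤ trapAverage cz (incorrect cz P) :=
  (trapAverage_const cz 0).symm.le.trans (trapAverage_mono fun c _ => incorrect_nonneg cz P c)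

theorem pInc_le_pErr (N : Noise n k) (cz : Fin k → CZCycle n) : pInc N cz ≤ pErr N := by
  rw [pInc_eq]
  refine sum_patternProb_mul_le N ?_ fun P => ?_
  · exact (trapAverage_mono fun c hc => (incorrect_noError cz hc).le).trans_eq
      (trapAverage_const cz 0)
  · exact (trapAverage_mono fun c _ => incorrect_le_one cz P c).trans_eq (trapAverage_const cz 1)

/-- Multiplying by `pErr` removes the conditioning in `pCanc`; the bound then holds pattern by
pattern, and extending the sum to the error-free pattern adds a nonnegative term. -/
theorem pErr_mul_one_sub_pCanc_le (N : Noise n k) (cz : Fin k → CZCycle n) :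
    pErr N * (1 - pCanc N cz) ≤ 2 * pInc N cz := by
  classical
  rcases eq_or_ne (pErr N) 0 with h | h
  · rw [h, zero_mul, pInc_eq]
    exact mul_nonneg zero_le_two (Finset.sum_nonneg fun P _ =>
      mul_nonneg (patternProb_nonneg N P) (trapAverage_incorrect_nonneg cz P))
  · rw [mul_sub, mul_one, pCanc, mul_div_cancel₀ _ h, pErr, ← Finset.sum_sub_distrib, pInc_eq,
      Finset.mul_sum]
    refine (Finset.sum_le_sum (g := fun P => 2 * (patternProb N P *
      trapAverage cz (incorrect cz P))) fun P _ => ?_).trans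
        (Finset.sum_le_sum_of_subset_of_nonneg (Finset.filter_subset _ _) fun P _ _ => ?_)
    · by_cases hP : patternProb N P = 0
      · simp [hP]
      · obtain ⟨h0, hm⟩ := isFlipString_of_patternProb_ne_zero hP
        have := mul_le_mul_of_nonneg_left (one_sub_trapAverage_cancels_le cz h0 hm)
          (patternProb_nonneg N P)
        linarith
    · exact mul_nonneg zero_le_two
        (mul_nonneg (patternProb_nonneg N P) (trapAverage_incorrect_nonneg cz P))

end Accreditation

theorem mainTheorem1 {n k : ℕ} (N : Accreditation.Noise n k)
    (cz : Fin k → Accreditation.CZCycle n) (U : Accreditation.Gates n k)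
    (hU : ∀ j i, U j i ∈ Matrix.unitaryGroup (Fin 2) ℂ) :
    (∀ j P, 0 ≤ Accreditation.errorRate N j P) ∧
    (∀ j, ∑ P, Accreditation.errorRate N j P = 1) ∧
    (∀ s, Accreditation.expDist N cz U s =
      ∑ P, Accreditation.patternProb N P * Accreditation.patternDist cz U P s) ∧
    Accreditation.varDist N cz U ≤ Accreditation.pErr N ∧
    (Accreditation.pCanc N cz < 1 →
      Accreditation.pErr N ≤ 2 * Accreditation.pInc N cz / (1 - Accreditation.pCanc N cz)) ∧
    Accreditation.pInc N cz ≤ Accreditation.pErr N :=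
  ⟨Accreditation.errorRate_nonneg N, Accreditation.sum_errorRate N,
    Accreditation.expDist_eq N cz U, Accreditation.varDist_le_pErr N cz hU,
    fun h => (le_div_iff₀ (sub_pos.2 h)).2 (Accreditation.pErr_mul_one_sub_pCanc_le N cz),
    Accreditation.pInc_le_pErr N cz⟩
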